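/- Let $F$ be any field and let $V$ be an $F$-vector space of finite dimension $d\ge 1$. Let $\mathcal T_V$ be the Tits building of $V$, i.e. the simplicial complex whose $p$-simplices are the flags $W_0\subsetneq\dots\subsetneq W_p$ of nonzero proper subspaces of $V$, and let $\mathrm{St}(V)=\widetilde H_{d-2}(\mathcal T_V,\mathbb Q)$ be the Steinberg module (so $\mathrm{St}(V)=\mathbb Q$ if $d=1$, the reduced homology of the empty complex in degree $-1$). A projective simplex $\mathcal P=(P_1,\dots,P_d)$ is an ordered $d$-tuple of lines in $V$; it is non-degenerate if $V=P_1\oplus\dots\oplus P_d$, and then it defines the apartment class \[ [\mathcal P]=\sum_{\sigma\in\mathfrak S_d}\operatorname{sgn}(\sigma)\bigl(P_{\sigma(1)}\subsetneq P_{\sigma(1)}+P_{\sigma(2)}\subsetneq\dots\subsetneq P_{\sigma(1)}+\dots+P_{\sigma(d-1)}\bigr)\in\mathrm{St}(V). \] A Coxeter pair is a pair $(\mathcal P,\mathcal Q)$ of non-degenerate projective simplexes such that $P_1=Q_1$ and $Q_i\subseteq P_{i-1}+P_i$ for $i=2,\dots,d$; the element $[\mathcal P]\otimes[\mathcal Q]\in\mathrm{St}(V)\otimes_{\mathbb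 Q}\mathrm{St}(V)$ is also called a Coxeter pair. Then: (1) For every hyperplane $H\subseteq V$ (a subspace of dimension $d-1$), the $\mathbb Q$-vector space $\mathrm{St}(V)\otimes_{\mathbb Q}\mathrm{St}(V)$ is spanned by the Coxeter pairs $[\mathcal P]\otimes[\mathcal Q]$ with $P_1,\dots,P_{d-1}\subseteq H$. (2) For every line $L\subseteq V$ (a subspace of dimension $1$), the $\mathbb Q$-vector space $\mathrm{St}(V)\otimes_{\mathbb Q}\mathrm{St}(V)$ is spanned by the Coxeter pairs $[\mathcal P]\otimes[\mathcal Q]$ with $P_1=Q_1=L$. -/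

import Mathlib

open scoped TensorProduct LinearAlgebra.Projectivization

noncomputable section

namespace SteinbergCoxeter

/-! ### Reduced simplicial homology of the order complex of a poset -/

section OrderComplex

variable (X : Type*) [PartialOrder X]

/-- Simplicial chains with rational coefficients of the order complex of `X`, indexed by the number
`n` of vertices: the free `ℚ`-vector space on the strictly increasing `n`-tuples of elements of `X`.
These are the chains of dimension `n - 1`; for `n = 0` there is exactly one (empty) tuple, so this
is the augmented chain complex. -/
abbrev Chains (n : ℕ) : Type _ := (Fin n ↪o X) →₀ ℚ

/-- The simplicial boundary `x₀ < ⋯ < xₙ ↦ ∑ i, (-1)ⁱ (x₀ < ⋯ < x̂ᵢ < ⋯ < xₙ)`. For `n = 0` it is the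
augmentation. -/
def boundary (n : ℕ) : Chains X (n + 1) →ₗ[ℚ] Chains X n :=
  Finsupp.lsum ℚ fun c : Fin (n + 1) ↪o X =>
    ∑ i : Fin (n + 1), (-1 : ℚ) ^ (i : ℕ) • Finsupp.lsingle ((Fin.succAboveOrderEmb i).trans c)

/-- The cycles of the augmented chain complex, among chains on `n` vertices. -/
def cycles : (n : ℕ) → Submodule ℚ (Chains X n)
  | 0 => ⊤
  | n + 1 => LinearMap.ker (boundary X n)

/-- The boundaries of the augmented chain complex, among chains on `n` vertices. -/
def boundaries (n : ℕ) : Submodule ℚ (Chains X n) := LinearMap.range (boundary X n)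

/-- The reduced rational homology, in degree `n - 1`, of the order complex of `X`. -/
abbrev ReducedHomology (n : ℕ) : Type _ :=
  cycles X n ⧸ (boundaries X n).comap (cycles X n).subtype

end OrderComplex

variable (F : Type*) [Field F] (V : Type*) [AddCommGroup V] [Module F V]

/-- The poset of nonzero proper subspaces of `V`. Its order complex is the Tits building of `V`. -/
abbrev ProperSubspace : Type _ := {W : Submodule F V // W ≠ ⊥ ∧ W ≠ ⊤}

/-- The Steinberg module `St(V)`: for `d = dim V`, the reduced homology with rational coefficients of
the Tits building of `V` in degree `d - 2`, that is, on chains with `d - 1` vertices. For `d = 1` this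
is `ℚ`, the reduced homology of the empty complex in degree `-1`; for `d = 0` truncated subtraction
gives `ℚ` as well, which is the usual convention. -/
abbrev Steinberg : Type _ := ReducedHomology (ProperSubspace F V) (Module.finrank F V - 1)

variable {F V}

/-! ### Apartments -/

/-- The subspace spanned by the points `P i`, `i ∈ s`. -/
def face {n : ℕ} (P : Fin n → ℙ F V) (s : Set (Fin n)) : Submodule F V :=
  ⨆ i ∈ s, (P i).submodule

theorem face_strictMono {n : ℕ} {P : Fin n → ℙ F V} (hP : Projectivization.Independent P) :
    StrictMono (face P) := by
  rw [Projectivization.independent_iff_iSupIndep] at hP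
  intro s t hst
  refine lt_of_le_of_ne (biSup_mono fun i hi => hst.1 hi) fun heq => ?_
  obtain ⟨i, hit, his⟩ := Set.exists_of_ssubset hst
  have h1 : (P i).submodule ≤ face P s := heq ▸ le_biSup (fun i => (P i).submodule) hit
  have h2 : face P s ≤ ⨆ (j : Fin n) (_ : j ≠ i), (P j).submodule :=
    biSup_mono fun j hj hji => his (hji ▸ hj)
  have h3 : (P i).submodule = ⊥ := disjoint_self.1 ((hP i).mono_right (h1.trans h2))
  have h4 := (P i).finrank_submodule
  rw [h3, finrank_bot] at h4
  exact zero_ne_one h4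

/-- For independent points `P₁, …, Pₙ` and a permutation `σ`, the flag
`⟨P_σ(1)⟩ < ⟨P_σ(1), P_σ(2)⟩ < ⋯ < ⟨P_σ(1), …, P_σ(n-1)⟩`. -/
def apartmentFlag {n : ℕ} (P : Fin n → ℙ F V) (hP : Projectivization.Independent P)
    (σ : Equiv.Perm (Fin n)) : Fin (n - 1) ↪o ProperSubspace F V :=
  OrderEmbedding.ofStrictMono
    (fun k => ⟨face P (σ '' {j : Fin n | (j : ℕ) ≤ k}), by
      have hk := k.isLt
      constructor
      · have h : face P ∅ < face P (σ '' {j : Fin n | (j : ℕ) ≤ k}) :=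
          face_strictMono hP (Set.empty_ssubset.2
            ⟨_, Set.mem_image_of_mem σ (show (⟨0, by omega⟩ : Fin n) ∈ {j : Fin n | (j : ℕ) ≤ k} by
              simp)⟩)
        exact (bot_le.trans_lt h).ne'
      · have h : face P (σ '' {j : Fin n | (j : ℕ) ≤ k}) < face P Set.univ := by
          refine face_strictMono hP (Set.ssubset_univ_iff.2 fun heq => ?_)
          have hm : σ ⟨n - 1, by omega⟩ ∈ σ '' {j : Fin n | (j : ℕ) ≤ k} := heq ▸ Set.mem_univ _
          rw [σ.injective.mem_set_image] at hm
          have : n - 1 ≤ (k : ℕ) := hm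
          omega
        exact (h.trans_le le_top).ne⟩)
    (fun k l hkl => by
      have hl := l.isLt
      refine Subtype.mk_lt_mk.2 (face_strictMono hP (σ.injective.image_strictMono ?_))
      have hkl' : (k : ℕ) < (l : ℕ) := hkl
      refine (Set.ssubset_iff_of_subset ?_).2 ⟨(⟨l, by omega⟩ : Fin n), ?_, ?_⟩
      · intro j hj
        exact le_trans (show (j : ℕ) ≤ k from hj) hkl'.le
      · exact le_refl (l : ℕ)
      · exact not_le.2 hkl')

/-- The chain `∑ σ, sign(σ) (⟨P_σ(1)⟩ < ⟨P_σ(1), P_σ(2)⟩ < ⋯ < ⟨P_σ(1), …, P_σ(n-1)⟩)`. -/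
def apartmentChain {n : ℕ} (P : Fin n → ℙ F V) (hP : Projectivization.Independent P) :
    Chains (ProperSubspace F V) (n - 1) :=
  ∑ σ : Equiv.Perm (Fin n), Finsupp.single (apartmentFlag P hP σ) ((Equiv.Perm.sign σ : ℤ) : ℚ)

theorem apartmentChain_mem_cycles {n : ℕ} (P : Fin n → ℙ F V)
    (hP : Projectivization.Independent P) :
    apartmentChain P hP ∈ cycles (ProperSubspace F V) (n - 1) := by
  match n, P, hP with
  | 0, _, _ => exact Submodule.mem_top
  | 1, _, _ => exact Submodule.mem_top
  | m + 2, P, hP =>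
    change boundary (ProperSubspace F V) m (apartmentChain P hP) = 0
    have key : ∀ i : Fin (m + 1), ∀ σ : Equiv.Perm (Fin (m + 2)),
        (Fin.succAboveOrderEmb i).trans
          (apartmentFlag P hP (σ * Equiv.swap i.castSucc i.succ)) =
        (Fin.succAboveOrderEmb i).trans (apartmentFlag P hP σ) := by
      intro i σ
      ext1 k
      refine Subtype.ext (congrArg (face P) ?_)
      rw [Equiv.Perm.coe_mul, Set.image_comp]
      congr 1
      have hne : ((i.succAbove k : Fin (m + 1)) : ℕ) ≠ i := fun h =>
        Fin.succAbove_ne i k (Fin.ext h)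
      have hsub : ∀ j : Fin (m + 2), (j : ℕ) ≤ (i.succAbove k : Fin (m + 1)) →
          ((Equiv.swap i.castSucc i.succ j : Fin (m + 2)) : ℕ) ≤
            (i.succAbove k : Fin (m + 1)) := by
        intro j hj
        rcases eq_or_ne j i.castSucc with rfl | h1
        · rw [Equiv.swap_apply_left]
          simp only [Fin.val_castSucc, Fin.val_succ] at hj ⊢
          omega
        rcases eq_or_ne j i.succ with rfl | h2
        · rw [Equiv.swap_apply_right]
          simp only [Fin.val_castSucc, Fin.val_succ] at hj ⊢
          omega
        · rwa [Equiv.swap_apply_of_ne_of_ne h1 h2]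
      ext j
      constructor
      · rintro ⟨j, hj, rfl⟩
        exact hsub j hj
      · intro hj
        exact ⟨_, hsub j hj, Equiv.swap_apply_self _ _ _⟩
    simp only [apartmentChain, boundary, map_sum, Finsupp.lsum_single, LinearMap.sum_apply]
    rw [Finset.sum_comm]
    refine Finset.sum_eq_zero fun i _ => ?_
    refine Finset.sum_involution (fun σ _ => σ * Equiv.swap i.castSucc i.succ) ?_ ?_ ?_ ?_
    · intro σ _
      have hs : Equiv.Perm.sign (Equiv.swap i.castSucc i.succ) = -1 :=
        Equiv.Perm.sign_swap (Fin.castSucc_lt_succ (i := i)).ne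
      simp only [LinearMap.smul_apply, Finsupp.lsingle_apply, Equiv.Perm.sign_mul, hs]
      erw [key i σ]
      rw [← smul_add, ← Finsupp.single_add]
      simp
    · intro σ _ _ h
      have : Equiv.swap i.castSucc i.succ = 1 := mul_eq_left.1 h
      exact (Fin.castSucc_lt_succ (i := i)).ne (Equiv.swap_eq_one_iff.1 this)
    · intro σ _
      exact Finset.mem_univ _
    · intro σ _
      rw [mul_assoc, Equiv.swap_mul_self, mul_one]

open Classical in
/-- The class `[P₁, …, P_d]` in `St(V)` of the apartment of a projective simplex, where
`d = dim V`. It is zero, by convention, when the simplex is degenerate. -/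
def apartment (P : Fin (Module.finrank F V) → ℙ F V) : Steinberg F V :=
  if hP : Projectivization.Independent P then
    Submodule.Quotient.mk ⟨apartmentChain P hP, apartmentChain_mem_cycles P hP⟩
  else 0

/-- Coxeter pairs of projective simplexes: both simplexes are non-degenerate, `P₁ = Q₁`, and `Qᵢ` lies
on the projective line `⟨Pᵢ₋₁, Pᵢ⟩` for `2 ≤ i ≤ d`. -/
structure IsCoxeterPair (P Q : Fin (Module.finrank F V) → ℙ F V) : Prop where
  left_independent : Projectivization.Independent P
  right_independent : Projectivization.Independent Q
  first_eq : ∀ i : Fin (Module.finrank F V), (i : ℕ) = 0 → P i = Q i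
  mem_line : ∀ i j : Fin (Module.finrank F V), (j : ℕ) = (i : ℕ) + 1 →
    (Q j).submodule ≤ (P i).submodule ⊔ (P j).submodule

end SteinbergCoxeter

end

open SteinbergCoxeter

noncomputable section

namespace SteinbergCoxeter

open Projectivization (Independent)

variable {F : Type*} [Field F] {V : Type*} [AddCommGroup V] [Module F V]

/-! ### Independent tuples of points -/

/-! Two facts about St(V) carry the proof: apartment classes span it (`span_range_apartment`), and
as functions of the tuple of lines they form a modular symbol (`isModularSymbol_apartment`). If S is
the span of the chosen Coxeter pairs, then `[P] ⊗ [Q]` modulo S is therefore a bimodular symbol, and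
the theorem says that a bimodular symbol vanishing on those pairs is zero.

The cocycle relation gives two reductions for a modular symbol: it suffices to test tuples starting
with a fixed point (`IsModularSymbol.eq_zero_of_cons`), or tuples whose first point alone lies off a
fixed hyperplane (`IsModularSymbol.eq_zero_of_hyperplane`). Both claims follow by induction on the
dimension.

For (1), reverse the order of the points. Reduce to `(p, P')` and `(q, Q')` with P', Q' in a
hyperplane and p, q outside it. The line pq meets the hyperplane in a point y. By induction P' and
Q' may be taken to be a reversed Coxeter pair starting at y, and then q lies on the line through p
and the first point of P' (`IsBimodularSymbol.eq_zero_of_revCoxeter_point`).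

For (2), reduce to `(x, P')` and `(x, Q')`, where P' and Q' lie in hyperplanes `ker h` and `ker k`
missing x. A transvection with direction x carries `ker h` to `ker k` and fixes their intersection.
Transporting Q' by it gives a bimodular symbol on `ker h`. A strengthened induction hypothesis, in
which all points of Q but the first lie in a given hyperplane, makes the transvection move only the
first point, along a line through x; the Coxeter condition survives this
(`IsBimodularSymbol.cons_eq_zero`).

The facts about apartments are proved with chains of full flags: the modular relation is a double
boundary computation (`sum_tupleChain_removeNth`), and spanning is a Solomon–Tits argument that
cones from a point (`flagCycles_le_apartmentSpan`). -/

theorem submodule_le_iff {p : ℙ F V} {W : Submodule F V} : p.submodule ≤ W ↔ p.rep ∈ W := by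
  rw [Projectivization.submodule_eq, Submodule.span_singleton_le_iff_mem]

theorem independent_comp {ι κ : Type*} {P : ι → ℙ F V} (hP : Independent P) {f : κ → ι}
    (hf : Function.Injective f) : Independent (P ∘ f) := by
  rw [Projectivization.independent_iff] at hP ⊢
  exact hP.comp f hf

theorem rep_comp_cons {n : ℕ} (x : ℙ F V) (P : Fin n → ℙ F V) :
    Projectivization.rep ∘ (Fin.cons x P : Fin (n + 1) → ℙ F V) =
      Fin.cons x.rep (Projectivization.rep ∘ P) := by
  funext i
  refine Fin.cases ?_ (fun j => ?_) i <;> simp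

theorem independent_of_cons {n : ℕ} {x : ℙ F V} {P : Fin n → ℙ F V}
    (h : Independent (Fin.cons x P : Fin (n + 1) → ℙ F V)) : Independent P := by
  have := independent_comp h (Fin.succ_injective n)
  rwa [show (Fin.cons x P : Fin (n + 1) → ℙ F V) ∘ Fin.succ = P from
    funext fun i => Fin.cons_succ _ _ _] at this

theorem independent_cons {n : ℕ} {x : ℙ F V} {P : Fin n → ℙ F V} {h : Module.Dual F V}
    (hP : Independent P) (hPh : ∀ i, h (P i).rep = 0) (hx : h x.rep ≠ 0) :
    Independent (Fin.cons x P : Fin (n + 1) → ℙ F V) := by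
  rw [Projectivization.independent_iff] at hP ⊢
  rw [rep_comp_cons, linearIndependent_finCons]
  refine ⟨hP, fun hmem => hx ?_⟩
  have : Submodule.span F (Set.range (Projectivization.rep ∘ P)) ≤ LinearMap.ker h := by
    rw [Submodule.span_le]
    rintro _ ⟨i, rfl⟩
    exact hPh i
  exact this hmem

theorem exists_dual_of_independent_cons {n : ℕ} {x : ℙ F V} {P : Fin n → ℙ F V}
    (h : Independent (Fin.cons x P : Fin (n + 1) → ℙ F V)) :
    ∃ f : Module.Dual F V, f x.rep = 1 ∧ ∀ i, f (P i).rep = 0 := by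
  rw [Projectivization.independent_iff, rep_comp_cons, linearIndependent_finCons] at h
  obtain ⟨f, hf, hle⟩ := Submodule.exists_le_ker_of_notMem h.2
  refine ⟨(f x.rep)⁻¹ • f, by simp [hf], fun i => ?_⟩
  have : f (P i).rep = 0 := hle (Submodule.subset_span ⟨i, rfl⟩)
  simp [this]

/-- The indices j and k may coincide, which covers a repeated point. -/
theorem not_independent_of_le_sup {ι : Type*} {P : ι → ℙ F V} {i j k : ι} (hj : i ≠ j)
    (hk : i ≠ k) (h : (P i).submodule ≤ (P j).submodule ⊔ (P k).submodule) :
    ¬ Independent P := by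
  intro hP
  rw [Projectivization.independent_iff_iSupIndep] at hP
  have h2 : (P j).submodule ⊔ (P k).submodule ≤ ⨆ (l : ι) (_ : l ≠ i), (P l).submodule :=
    sup_le (le_iSup₂_of_le j hj.symm le_rfl) (le_iSup₂_of_le k hk.symm le_rfl)
  have h3 : (P i).submodule = ⊥ := disjoint_self.1 ((hP i).mono_right (h.trans h2))
  have h4 := (P i).finrank_submodule
  rw [h3, finrank_bot] at h4
  exact zero_ne_one h4

theorem not_independent_of_finrank_lt [FiniteDimensional F V] {n : ℕ} {P : Fin n → ℙ F V}
    {W : Submodule F V} (hP : ∀ i, (P i).submodule ≤ W) (hW : Module.finrank F W < n) :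
    ¬ Independent P := by
  intro h
  rw [Projectivization.independent_iff] at h
  have h1 := finrank_span_eq_card h
  have h2 : Submodule.span F (Set.range (Projectivization.rep ∘ P)) ≤ W := by
    rw [Submodule.span_le]
    rintro _ ⟨i, rfl⟩
    exact submodule_le_iff.1 (hP i)
  have h3 := Submodule.finrank_mono h2
  rw [h1, Fintype.card_fin] at h3
  omega

theorem finrank_inf_ker [FiniteDimensional F V] {n : ℕ} {W : Submodule F V}
    (hW : Module.finrank F W = n + 1) {k : Module.Dual F V} {w : V} (hw : w ∈ W) (hk : k w ≠ 0) :
    Module.finrank F (W ⊓ LinearMap.ker k : Submodule F V) = n := by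
  have h1 := LinearMap.finrank_range_add_finrank_ker (k.domRestrict W)
  have h2 : LinearMap.range (k.domRestrict W) = ⊤ := by
    rw [LinearMap.range_eq_top]
    refine LinearMap.surjective_of_ne_zero fun h => hk ?_
    simpa using LinearMap.congr_fun h ⟨w, hw⟩
  have h3 : Module.finrank F (LinearMap.ker (k.domRestrict W)) =
      Module.finrank F (W ⊓ LinearMap.ker k : Submodule F V) := by
    rw [LinearMap.ker_domRestrict, ← Submodule.map_comap_subtype,
      LinearEquiv.finrank_eq (Submodule.equivMapOfInjective _ W.injective_subtype _)]
  rw [h2, finrank_top, Module.finrank_self, h3, hW] at h1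
  omega

theorem eq_of_submodule_le {p q : ℙ F V} (h : p.submodule ≤ q.submodule) : p = q := by
  have : FiniteDimensional F q.submodule :=
    Module.finite_of_finrank_pos (by rw [q.finrank_submodule]; exact one_pos)
  exact Projectivization.submodule_injective
    (Submodule.eq_of_le_of_finrank_eq h (by rw [p.finrank_submodule, q.finrank_submodule]))

/-! ### Modular symbols -/

variable {M : Type*} [AddCommGroup M]

/-- A function on `n`-tuples of points that vanishes on dependent tuples and satisfies the cocycle
relation on dependent `(n + 1)`-tuples. -/
structure IsModularSymbol {n : ℕ} (ψ : (Fin n → ℙ F V) → M) : Prop where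
  degenerate : ∀ P, ¬ Independent P → ψ P = 0
  relation : ∀ P : Fin (n + 1) → ℙ F V, ¬ Independent P →
    ∑ i : Fin (n + 1), (-1 : ℤ) ^ (i : ℕ) • ψ (i.removeNth P) = 0

theorem removeNth_succ_cons {n : ℕ} {α : Type*} (x : α) (P : Fin (n + 1) → α) (i : Fin (n + 1)) :
    i.succ.removeNth (Fin.cons x P : Fin (n + 2) → α) = Fin.cons x (i.removeNth P) :=
  Fin.cons_comp_succ_succAbove x P i

/-- The exchange formula: solve the cocycle relation of `(x, P)` for the face that omits x. Every
reduction below is an instance of it. -/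
theorem IsModularSymbol.eq_sum_cons {n : ℕ} {ψ : (Fin (n + 1) → ℙ F V) → M}
    (hψ : IsModularSymbol ψ) (x : ℙ F V) (P : Fin (n + 1) → ℙ F V)
    (h : ¬ Independent (Fin.cons x P : Fin (n + 2) → ℙ F V)) :
    ψ P = ∑ i : Fin (n + 1), (-1 : ℤ) ^ (i : ℕ) • ψ (Fin.cons x (i.removeNth P)) := by
  have h1 := hψ.relation _ h
  rw [Fin.sum_univ_succ] at h1
  simp only [removeNth_succ_cons, Fin.val_succ, pow_succ, mul_neg, mul_one, neg_smul,
    Finset.sum_neg_distrib, Fin.val_zero, pow_zero, one_smul, Fin.removeNth_zero,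
    Fin.tail_cons] at h1
  exact add_neg_eq_zero.1 h1

theorem IsModularSymbol.cons {n : ℕ} {ψ : (Fin (n + 1) → ℙ F V) → M} (hψ : IsModularSymbol ψ)
    (x : ℙ F V) : IsModularSymbol fun P : Fin n → ℙ F V => ψ (Fin.cons x P) where
  degenerate P hP := hψ.degenerate _ fun h => hP (independent_of_cons h)
  relation P hP := by
    rw [← hψ.eq_sum_cons x P fun h => hP (independent_of_cons h)]
    exact hψ.degenerate P hP

theorem IsModularSymbol.comp_rev {n : ℕ} {ψ : (Fin n → ℙ F V) → M} (hψ : IsModularSymbol ψ) :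
    IsModularSymbol fun P : Fin n → ℙ F V => ψ (P ∘ Fin.rev) where
  degenerate P hP := hψ.degenerate _ fun h => hP <| by
    have := independent_comp h Fin.rev_injective
    rwa [Function.comp_assoc, Fin.rev_involutive.comp_self] at this
  relation P hP := by
    have h1 := hψ.relation (P ∘ Fin.rev) fun h => hP <| by
      have := independent_comp h Fin.rev_injective
      rwa [Function.comp_assoc, Fin.rev_involutive.comp_self] at this
    rw [← Equiv.sum_comp Fin.revPerm] at h1
    -- Reversal turns the i-th face into the (n - i)-th, so the two relations differ by the global
    -- sign (-1)ⁿ.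
    have h2 := congrArg (fun m => (-1 : ℤ) ^ n • m) h1
    simp only [smul_zero, Finset.smul_sum] at h2
    rw [← h2]
    refine Finset.sum_congr rfl fun i _ => ?_
    rw [smul_smul, ← pow_add]
    congr 1
    · have hi := i.is_le
      rw [show n + ((Fin.revPerm i : Fin (n + 1)) : ℕ) = (i : ℕ) + 2 * (n - i) by
        simp only [Fin.revPerm_apply, Fin.val_rev]; omega, pow_add, pow_mul]
      simp
    · congr 1
      funext j
      simp [Fin.removeNth_apply, Fin.rev_succAbove]

/-! ### Linear automorphisms acting on tuples -/

theorem submodule_map (g : V ≃ₗ[F] V) (p : ℙ F V) :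
    (Projectivization.map g.toLinearMap g.injective p).submodule =
      p.submodule.map g.toLinearMap := by
  induction p using Projectivization.ind with
  | h v hv =>
    rw [Projectivization.map_mk, Projectivization.submodule_mk, Projectivization.submodule_mk,
      Submodule.map_span, Set.image_singleton]

theorem independent_map_iff {ι : Type*} (g : V ≃ₗ[F] V) {P : ι → ℙ F V} :
    Independent (Projectivization.map g.toLinearMap g.injective ∘ P) ↔ Independent P := by
  rw [Projectivization.independent_iff_iSupIndep, Projectivization.independent_iff_iSupIndep,
    ← iSupIndep_map_orderIso_iff (Submodule.orderIsoMapComap g) (a := fun i => (P i).submodule)]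
  simp only [Function.comp_def, submodule_map]
  rfl

theorem IsModularSymbol.comp_map {n : ℕ} {ψ : (Fin n → ℙ F V) → M} (hψ : IsModularSymbol ψ)
    (g : V ≃ₗ[F] V) : IsModularSymbol fun P : Fin n → ℙ F V =>
      ψ (Projectivization.map g.toLinearMap g.injective ∘ P) :=
  ⟨fun _ hP => hψ.degenerate _ ((independent_map_iff g).not.2 hP),
    fun _ hP => hψ.relation _ ((independent_map_iff g).not.2 hP)⟩

/-- Modular symbols on a subspace are determined by their values on tuples starting with a given
point. -/
theorem IsModularSymbol.eq_zero_of_cons [FiniteDimensional F V] {n : ℕ}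
    {ψ : (Fin (n + 1) → ℙ F V) → M} (hψ : IsModularSymbol ψ) {W : Submodule F V}
    (hW : Module.finrank F W = n + 1) {x : ℙ F V} (hx : x.submodule ≤ W)
    (h : ∀ P : Fin n → ℙ F V, (∀ i, (P i).submodule ≤ W) → ψ (Fin.cons x P) = 0)
    {P : Fin (n + 1) → ℙ F V} (hP : ∀ i, (P i).submodule ≤ W) : ψ P = 0 := by
  rw [hψ.eq_sum_cons x P]
  · exact Finset.sum_eq_zero fun i _ => by
      rw [h (i.removeNth P) fun j => hP _, smul_zero]
  · refine not_independent_of_finrank_lt (W := W) (fun i => ?_) (by omega)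
    exact Fin.cases hx hP i

/-- Modular symbols on a subspace are determined by their values on tuples all of whose points
but the first lie on a given hyperplane. -/
theorem IsModularSymbol.eq_zero_of_hyperplane [FiniteDimensional F V] {n : ℕ}
    {ψ : (Fin (n + 1) → ℙ F V) → M} (hψ : IsModularSymbol ψ) {W : Submodule F V}
    (hW : Module.finrank F W = n + 1) {k : Module.Dual F V} {w : V} (hw : w ∈ W) (hk : k w ≠ 0)
    (h : ∀ (x : ℙ F V) (P : Fin n → ℙ F V), x.submodule ≤ W → k x.rep ≠ 0 →
      (∀ i, (P i).submodule ≤ W ⊓ LinearMap.ker k) → ψ (Fin.cons x P) = 0)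
    {P : Fin (n + 1) → ℙ F V} (hP : ∀ i, (P i).submodule ≤ W) : ψ P = 0 := by
  classical
  -- Induction on the number of points off `ker k`. With none, the tuple is dependent; with one, an
  -- exchange moves it to the front; with more, exchanging with the point where the line through two
  -- of them meets `ker k` lowers the number.
  induction hc : (Finset.univ.filter fun i => k (P i).rep ≠ 0).card using Nat.strong_induction_on
    generalizing P with
  | _ c ih =>
  by_cases h0 : ∀ i, k (P i).rep = 0
  · refine hψ.degenerate P (not_independent_of_finrank_lt (W := W ⊓ LinearMap.ker k)
      (fun i => ?_) (by rw [finrank_inf_ker hW hw hk]; omega))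
    exact le_inf (hP i) (submodule_le_iff.2 (h0 i))
  push Not at h0
  obtain ⟨i, hi⟩ := h0
  by_cases h1 : ∀ j, j ≠ i → k (P j).rep = 0
  -- Exchange with `P i` itself: every term that keeps `P i` has it twice and vanishes.
  · rw [hψ.eq_sum_cons (P i) P]
    · refine Finset.sum_eq_zero fun j _ => ?_
      by_cases hj : j = i
      · subst hj
        rw [h _ _ (hP j) hi, smul_zero]
        intro l
        exact le_inf (hP _) (submodule_le_iff.2 (h1 _ (Fin.succAbove_ne j l)))
      · obtain ⟨l, hl⟩ := Fin.exists_succAbove_eq (Ne.symm hj)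
        rw [hψ.degenerate, smul_zero]
        refine not_independent_of_le_sup (i := 0) (j := l.succ) (k := l.succ)
          (Fin.succ_ne_zero l).symm (Fin.succ_ne_zero l).symm ?_
        simp [Fin.removeNth_apply, hl]
    · refine not_independent_of_le_sup (i := 0) (j := i.succ) (k := i.succ)
          (Fin.succ_ne_zero i).symm (Fin.succ_ne_zero i).symm ?_
      simp
  push Not at h1
  obtain ⟨i', hi', hki'⟩ := h1
  by_cases hPP : P i = P i'
  · refine hψ.degenerate P (not_independent_of_le_sup hi'.symm hi'.symm (by rw [hPP]; simp))
  -- This vector spans the intersection of the line through `P i` and `P i'` with `ker k`.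
  set v : V := k (P i').rep • (P i).rep - k (P i).rep • (P i').rep with hv
  have hv0 : v ≠ 0 := by
    intro h0
    have hind := (Projectivization.linearIndependent_pair_iff_ne (D := P i) (D' := P i')).2 hPP
    have := (LinearIndependent.pair_iff.1 hind) (k (P i').rep) (-k (P i).rep) (by
      rw [← h0, hv, neg_smul, sub_eq_add_neg])
    exact hki' this.1
  have hx : (Projectivization.mk F v hv0).submodule ≤ (P i).submodule ⊔ (P i').submodule := by
    rw [Projectivization.submodule_mk, Submodule.span_singleton_le_iff_mem]
    refine sub_mem (Submodule.smul_mem _ _ (Submodule.mem_sup_left ?_))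
      (Submodule.smul_mem _ _ (Submodule.mem_sup_right ?_)) <;>
    · rw [Projectivization.submodule_eq]; exact Submodule.mem_span_singleton_self _
  have hxW : (Projectivization.mk F v hv0).submodule ≤ W := hx.trans (sup_le (hP i) (hP i'))
  have hxk : k (Projectivization.mk F v hv0).rep = 0 := by
    have : (Projectivization.mk F v hv0).submodule ≤ LinearMap.ker k := by
      rw [Projectivization.submodule_mk, Submodule.span_singleton_le_iff_mem]
      simp [hv, mul_comm]
    exact submodule_le_iff.1 this
  have hdrop : ∀ j, k (P j).rep ≠ 0 →
      ψ (Fin.cons (Projectivization.mk F v hv0) (j.removeNth P)) = 0 := by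
    intro j hj
    refine ih _ ?_ (P := Fin.cons (Projectivization.mk F v hv0) (j.removeNth P))
      (fun l => ?_) rfl
    · rw [← hc, Finset.card_filter, Finset.card_filter, Fin.sum_univ_succ,
        Fin.sum_univ_succAbove _ j]
      simp [hxk, hj, Fin.removeNth_apply]
    · exact Fin.cases hxW (fun _ => hP _) l
  rw [hψ.eq_sum_cons (Projectivization.mk F v hv0) P]
  · refine Finset.sum_eq_zero fun j _ => ?_
    by_cases hj : k (P j).rep ≠ 0
    · rw [hdrop j hj, smul_zero]
    -- Here j is neither i nor i', so the term contains both points together with a third point of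
    -- their line.
    · obtain ⟨l, hl⟩ := Fin.exists_succAbove_eq (x := i) (y := j) (by rintro rfl; exact hj hi)
      obtain ⟨l', hl'⟩ := Fin.exists_succAbove_eq (x := i') (y := j) (by rintro rfl; exact hj hki')
      rw [hψ.degenerate, smul_zero]
      refine not_independent_of_le_sup (i := 0) (j := l.succ) (k := l'.succ)
          (Fin.succ_ne_zero l).symm (Fin.succ_ne_zero l').symm ?_
      simpa [Fin.removeNth_apply, hl, hl'] using hx
  · refine not_independent_of_le_sup (i := 0) (j := i.succ) (k := i'.succ)
          (Fin.succ_ne_zero i).symm (Fin.succ_ne_zero i').symm ?_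
    simpa using hx

/-! ### Bimodular symbols and Coxeter tuples -/

/-- A function of two tuples of points that is a modular symbol in each of them. -/
structure IsBimodularSymbol {n : ℕ} (φ : (Fin n → ℙ F V) → (Fin n → ℙ F V) → M) : Prop where
  left : ∀ Q, IsModularSymbol fun P => φ P Q
  right : ∀ P, IsModularSymbol (φ P)

theorem IsBimodularSymbol.cons {n : ℕ} {φ : (Fin (n + 1) → ℙ F V) → (Fin (n + 1) → ℙ F V) → M}
    (hφ : IsBimodularSymbol φ) (x y : ℙ F V) :
    IsBimodularSymbol fun P Q : Fin n → ℙ F V => φ (Fin.cons x P) (Fin.cons y Q) where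
  left Q := (hφ.left (Fin.cons y Q)).cons x
  right P := (hφ.right (Fin.cons x P)).cons y

/-- Coxeter pairs of `n`-tuples of points, in a space of arbitrary dimension. -/
structure IsCoxeterTuple {n : ℕ} (P Q : Fin n → ℙ F V) : Prop where
  left_independent : Independent P
  right_independent : Independent Q
  first_eq : ∀ i : Fin n, (i : ℕ) = 0 → P i = Q i
  mem_line : ∀ i j : Fin n, (j : ℕ) = i + 1 → (Q j).submodule ≤ (P i).submodule ⊔ (P j).submodule

/-- Coxeter pairs of tuples, with the order of the points reversed. -/
structure IsRevCoxeterTuple {n : ℕ} (P Q : Fin n → ℙ F V) : Prop where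
  left_independent : Independent P
  right_independent : Independent Q
  last_eq : ∀ i : Fin n, (i : ℕ) + 1 = n → P i = Q i
  mem_line : ∀ i j : Fin n, (j : ℕ) = i + 1 → (Q i).submodule ≤ (P i).submodule ⊔ (P j).submodule

theorem IsRevCoxeterTuple.comp_rev {n : ℕ} {P Q : Fin n → ℙ F V} (h : IsRevCoxeterTuple P Q) :
    IsCoxeterTuple (P ∘ Fin.rev) (Q ∘ Fin.rev) where
  left_independent := independent_comp h.left_independent Fin.rev_injective
  right_independent := independent_comp h.right_independent Fin.rev_injective
  first_eq i hi := h.last_eq _ (by rw [Fin.val_rev]; omega)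
  mem_line i j hij := by
    rw [sup_comm]
    exact h.mem_line _ _ (by simp only [Fin.val_rev]; omega)

theorem exists_point_le [FiniteDimensional F V] {n : ℕ} {W : Submodule F V}
    (hW : Module.finrank F W = n + 1) : ∃ x : ℙ F V, x.submodule ≤ W := by
  obtain ⟨v, hv⟩ := (Module.finrank_pos_iff_exists_ne_zero (R := F) (M := W)).1
    (by rw [hW]; exact Nat.succ_pos n)
  refine ⟨Projectivization.mk F (v : V) (by simpa using hv), ?_⟩
  rw [Projectivization.submodule_mk, Submodule.span_singleton_le_iff_mem]
  exact v.2

/-- The point y is where the line through x and q meets `ker k`. If q = x, any point of the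
hyperplane section serves, and the dimension hypothesis provides one. -/
theorem exists_mem_line_inf_ker {n : ℕ} [FiniteDimensional F V] {W : Submodule F V}
    {k : Module.Dual F V} (hW : Module.finrank F (W ⊓ LinearMap.ker k : Submodule F V) = n + 1)
    {x q : ℙ F V} (hx : x.submodule ≤ W) (hq : q.submodule ≤ W) (hkx : k x.rep ≠ 0) :
    ∃ y : ℙ F V, y.submodule ≤ W ⊓ LinearMap.ker k ∧
      q.submodule ≤ x.submodule ⊔ y.submodule := by
  by_cases hqx : q = x
  · obtain ⟨y, hy⟩ := exists_point_le hW
    exact ⟨y, hy, hqx ▸ le_sup_left⟩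
  set v : V := k x.rep • q.rep - k q.rep • x.rep with hv
  have hv0 : v ≠ 0 := by
    intro h0
    have hind := (Projectivization.linearIndependent_pair_iff_ne (D := q) (D' := x)).2 hqx
    have := (LinearIndependent.pair_iff.1 hind) (k x.rep) (-k q.rep) (by
      rw [← h0, hv, neg_smul, sub_eq_add_neg])
    exact hkx this.1
  refine ⟨Projectivization.mk F v hv0, ?_, ?_⟩
  · rw [Projectivization.submodule_mk, Submodule.span_singleton_le_iff_mem]
    refine ⟨sub_mem (W.smul_mem _ (submodule_le_iff.1 hq)) (W.smul_mem _ (submodule_le_iff.1 hx)),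
      ?_⟩
    simp [hv, mul_comm]
  · rw [submodule_le_iff, Projectivization.submodule_mk, Projectivization.submodule_eq]
    have : q.rep = ((k x.rep)⁻¹ * k q.rep) • x.rep + (k x.rep)⁻¹ • v := by
      rw [hv, smul_sub, smul_smul, smul_smul, inv_mul_cancel₀ hkx]
      simp
    rw [this]
    exact add_mem
      (Submodule.mem_sup_left (Submodule.smul_mem _ _ (Submodule.mem_span_singleton_self _)))
      (Submodule.mem_sup_right (Submodule.smul_mem _ _ (Submodule.mem_span_singleton_self _)))

/-- In the reversed order, prepending a point to each tuple adds a single incidence condition, which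
involves only the first point of P. The functional k certifies independence. -/
theorem IsRevCoxeterTuple.cons {n : ℕ} {P Q : Fin (n + 1) → ℙ F V} (h : IsRevCoxeterTuple P Q)
    {k : Module.Dual F V} (hP : ∀ i, k (P i).rep = 0) (hQ : ∀ i, k (Q i).rep = 0) {x q : ℙ F V}
    (hx : k x.rep ≠ 0) (hq : k q.rep ≠ 0) (hl : q.submodule ≤ x.submodule ⊔ (P 0).submodule) :
    IsRevCoxeterTuple (Fin.cons x P : Fin (n + 2) → ℙ F V) (Fin.cons q Q) where
  left_independent := independent_cons h.left_independent hP hx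
  right_independent := independent_cons h.right_independent hQ hq
  last_eq i := by
    refine Fin.cases (fun h0 => ?_) (fun j hj => ?_) i
    · simp at h0
    · simp only [Fin.cons_succ]
      exact h.last_eq j (by simpa using hj)
  mem_line i j := by
    refine Fin.cases (fun h0 => ?_) (fun j hj => ?_) j
    · simp at h0
    · revert hj
      refine Fin.cases (fun h0 => ?_) (fun i hi => ?_) i
      · obtain rfl : j = 0 := Fin.ext (by simpa using h0)
        simpa using hl
      · simp only [Fin.cons_succ]
        exact h.mem_line i j (by simpa using hi)

theorem eq_of_finrank_eq_one {W : Submodule F V} (hW : Module.finrank F W = 1)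
    {p q : ℙ F V} (hp : p.submodule ≤ W) (hq : q.submodule ≤ W) : p = q := by
  have : FiniteDimensional F W := Module.finite_of_finrank_pos (by rw [hW]; exact one_pos)
  exact eq_of_submodule_le <| hp.trans
    (Submodule.eq_of_le_of_finrank_eq hq (by rw [hW, q.finrank_submodule])).ge

theorem independent_fin_one (P : Fin 1 → ℙ F V) : Independent P := by
  rw [Projectivization.independent_iff]
  exact LinearIndependent.of_subsingleton 0 (P 0).rep_nonzero

/-- A bimodular symbol on `W` that vanishes on reversed Coxeter tuples starting with a given point
is zero on `W`. -/
theorem IsBimodularSymbol.eq_zero_of_revCoxeter_point [FiniteDimensional F V] {n : ℕ} :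
    ∀ {φ : (Fin (n + 1) → ℙ F V) → (Fin (n + 1) → ℙ F V) → M} (_ : IsBimodularSymbol φ)
      {W : Submodule F V} (_ : Module.finrank F W = n + 1) {x : ℙ F V} (_ : x.submodule ≤ W)
      (_ : ∀ P Q : Fin (n + 1) → ℙ F V, IsRevCoxeterTuple P Q → (∀ i, (P i).submodule ≤ W) →
        (∀ i, (Q i).submodule ≤ W) → P 0 = x → φ P Q = 0)
      {P Q : Fin (n + 1) → ℙ F V} (_ : ∀ i, (P i).submodule ≤ W) (_ : ∀ i, (Q i).submodule ≤ W),
      φ P Q = 0 := by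
  induction n with
  | zero =>
    intro φ hφ W hW x hx h P Q hP hQ
    refine h P Q ⟨independent_fin_one P, independent_fin_one Q, fun i _ => ?_, fun i j hij => ?_⟩
      hP hQ (eq_of_finrank_eq_one hW (hP 0) hx)
    · exact eq_of_finrank_eq_one hW (hP i) (hQ i)
    · omega
  | succ n ih =>
    intro φ hφ W hW x hx h P Q hP hQ
    refine (hφ.left Q).eq_zero_of_cons hW hx (fun P' hP' => ?_) hP
    by_cases hind : Independent (Fin.cons x P' : Fin (n + 2) → ℙ F V)
    swap
    · exact (hφ.left Q).degenerate _ hind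
    obtain ⟨k, hkx, hkP⟩ := exists_dual_of_independent_cons hind
    have hkx0 : k x.rep ≠ 0 := by rw [hkx]; exact one_ne_zero
    have hxW := submodule_le_iff.1 hx
    -- The hyperplane used for Q is dictated by P': it is the complement of x spanned by P'.
    refine (hφ.right _).eq_zero_of_hyperplane hW hxW hkx0 (fun q Q' hq hkq hQ' => ?_) hQ
    have hW' := finrank_inf_ker hW hxW hkx0
    -- Prescribing y as starting point in the smaller space yields exactly the new condition that q
    -- lies on the line through x and the next point.
    obtain ⟨y, hy, hqy⟩ := exists_mem_line_inf_ker hW' hx hq hkx0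
    refine ih (hφ.cons x q) hW' hy (fun P'' Q'' hPQ hP'' hQ'' h0 => ?_)
      (fun i => le_inf (hP' i) (submodule_le_iff.2 (hkP i))) hQ'
    refine h _ _ (hPQ.cons (k := k) (fun i => (submodule_le_iff.1 (hP'' i)).2)
      (fun i => (submodule_le_iff.1 (hQ'' i)).2) hkx0 hkq (h0 ▸ hqy)) ?_ ?_ rfl
    · exact Fin.cases hx fun i => (hP'' i).trans inf_le_left
    · exact Fin.cases hq fun i => (hQ'' i).trans inf_le_left

/-- A bimodular symbol on `W` that vanishes on reversed Coxeter tuples `P, Q` such that all points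
of `P` but the first are on a given hyperplane is zero on `W`. -/
theorem IsBimodularSymbol.eq_zero_of_revCoxeter_hyperplane [FiniteDimensional F V] {n : ℕ}
    {φ : (Fin (n + 1) → ℙ F V) → (Fin (n + 1) → ℙ F V) → M} (hφ : IsBimodularSymbol φ)
    {W : Submodule F V} (hW : Module.finrank F W = n + 1) {k : Module.Dual F V} {w : V}
    (hw : w ∈ W) (hkw : k w ≠ 0)
    (h : ∀ P Q : Fin (n + 1) → ℙ F V, IsRevCoxeterTuple P Q →
      (∀ i : Fin n, k (P i.succ).rep = 0) → φ P Q = 0)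
    {P Q : Fin (n + 1) → ℙ F V} (hP : ∀ i, (P i).submodule ≤ W) (hQ : ∀ i, (Q i).submodule ≤ W) :
    φ P Q = 0 := by
  rcases n with _ | n
  · refine h P Q ⟨independent_fin_one P, independent_fin_one Q, fun i _ => ?_, fun i j hij => ?_⟩
      fun i => i.elim0
    · exact eq_of_finrank_eq_one hW (hP i) (hQ i)
    · omega
  refine (hφ.left Q).eq_zero_of_hyperplane hW hw hkw (fun p P' hp hkp hP' => ?_) hP
  refine (hφ.right _).eq_zero_of_hyperplane hW hw hkw (fun q Q' hq hkq hQ' => ?_) hQ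
  have hW' := finrank_inf_ker hW hw hkw
  obtain ⟨y, hy, hqy⟩ := exists_mem_line_inf_ker hW' hp hq hkp
  refine (hφ.cons p q).eq_zero_of_revCoxeter_point hW' hy (fun P'' Q'' hPQ hP'' hQ'' h0 => ?_)
    hP' hQ'
  refine h _ _ (hPQ.cons (k := k) (fun i => (submodule_le_iff.1 (hP'' i)).2)
    (fun i => (submodule_le_iff.1 (hQ'' i)).2) hkp hkq (h0 ▸ hqy)) fun i => ?_
  simpa using (submodule_le_iff.1 (hP'' i)).2

/-! ### Transvections and Coxeter tuples in the original order -/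

theorem IsBimodularSymbol.comp_map_right {n : ℕ} {φ : (Fin n → ℙ F V) → (Fin n → ℙ F V) → M}
    (hφ : IsBimodularSymbol φ) (g : V ≃ₗ[F] V) :
    IsBimodularSymbol fun P Q : Fin n → ℙ F V =>
      φ P (Projectivization.map g.toLinearMap g.injective ∘ Q) where
  left _ := hφ.left _
  right P := (hφ.right P).comp_map g

theorem map_transvection_le {f : Module.Dual F V} {v : V} (hf : f v = 0) (p : ℙ F V) :
    (Projectivization.map (LinearEquiv.transvection hf).toLinearMap
      (LinearEquiv.transvection hf).injective p).submodule ≤ Submodule.span F {v} ⊔ p.submodule := by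
  rw [submodule_map, Projectivization.submodule_eq, Submodule.map_span, Set.image_singleton,
    Submodule.span_singleton_le_iff_mem, LinearEquiv.coe_coe, LinearEquiv.transvection.apply,
    add_comm]
  exact add_mem (Submodule.mem_sup_left (Submodule.smul_mem _ _ (Submodule.mem_span_singleton_self _)))
    (Submodule.mem_sup_right (Submodule.mem_span_singleton_self _))

theorem dual_rep_eq_zero_iff {k : Module.Dual F V} {p : ℙ F V} :
    k p.rep = 0 ↔ p.submodule ≤ LinearMap.ker k := by
  rw [submodule_le_iff, LinearMap.mem_ker]

theorem dual_map_rep_eq_zero {g : V ≃ₗ[F] V} {h k : Module.Dual F V} (hk : ∀ v, k (g v) = h v)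
    {p : ℙ F V} (hp : h p.rep = 0) :
    k (Projectivization.map g.toLinearMap g.injective p).rep = 0 := by
  rw [dual_rep_eq_zero_iff] at hp ⊢
  rw [submodule_map, Submodule.map_le_iff_le_comap]
  intro v hv
  simpa [hk] using hp hv

theorem map_transvection_eq {f : Module.Dual F V} {v : V} (hf : f v = 0) {p : ℙ F V}
    (hp : f p.rep = 0) :
    Projectivization.map (LinearEquiv.transvection hf).toLinearMap
      (LinearEquiv.transvection hf).injective p = p := by
  refine eq_of_submodule_le ?_
  rw [submodule_map, Projectivization.submodule_eq, Submodule.map_span, Set.image_singleton,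
    Submodule.span_singleton_le_iff_mem, LinearEquiv.coe_coe, LinearEquiv.transvection.apply, hp,
    zero_smul, add_zero]
  exact Submodule.mem_span_singleton_self _

/-- The first point of Q equals that of P, so it may slide along its line to x: the result lies on
the line through x and `P 0`. The later points, and their conditions, stay unchanged. -/
theorem IsCoxeterTuple.cons {n : ℕ} {P Q Q' : Fin (n + 1) → ℙ F V} (h : IsCoxeterTuple P Q)
    {k k' : Module.Dual F V} {x : ℙ F V} (hP : ∀ i, k (P i).rep = 0)
    (hQ' : ∀ i, k' (Q' i).rep = 0) (hind : Independent Q') (hx : k x.rep ≠ 0) (hx' : k' x.rep ≠ 0)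
    (h0 : (Q' 0).submodule ≤ x.submodule ⊔ (Q 0).submodule) (hs : ∀ i : Fin n, Q' i.succ = Q i.succ) :
    IsCoxeterTuple (Fin.cons x P : Fin (n + 2) → ℙ F V) (Fin.cons x Q') where
  left_independent := independent_cons h.left_independent hP hx
  right_independent := independent_cons hind hQ' hx'
  first_eq i := by
    refine Fin.cases (fun _ => rfl) (fun j hj => ?_) i
    simp at hj
  mem_line i j := by
    refine Fin.cases (fun h0 => ?_) (fun j hj => ?_) j
    · simp at h0
    · revert hj
      refine Fin.cases (fun hj => ?_) (fun i hi => ?_) i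
      · obtain rfl : j = 0 := Fin.ext (by simpa using hj)
        simpa [h.first_eq 0 rfl] using h0
      · have hi' : (j : ℕ) = i + 1 := by simpa using hi
        obtain ⟨l, rfl⟩ : ∃ l : Fin n, j = l.succ :=
          Fin.exists_succ_eq_of_ne_zero (by rintro rfl; simp at hi') |>.imp fun _ h => h.symm
        simp only [Fin.cons_succ, hs]
        exact h.mem_line i _ hi'

/-- The inductive step for Coxeter tuples: the statement on a hyperplane of `W` gives the one for
tuples starting at a given point `x` outside two given hyperplanes. -/
theorem IsBimodularSymbol.cons_eq_zero [FiniteDimensional F V] {n : ℕ}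
    {φ : (Fin (n + 2) → ℙ F V) → (Fin (n + 2) → ℙ F V) → M} (hφ : IsBimodularSymbol φ)
    {W : Submodule F V} (hW : Module.finrank F W = n + 2) {x : ℙ F V} (hx : x.submodule ≤ W)
    {h k : Module.Dual F V} (hhx : h x.rep = 1) (hkx : k x.rep = 1)
    (ih : ∀ {φ : (Fin (n + 1) → ℙ F V) → (Fin (n + 1) → ℙ F V) → M} (_ : IsBimodularSymbol φ)
      {W : Submodule F V} (_ : Module.finrank F W = n + 1) (k : Module.Dual F V)
      (_ : ∀ P Q : Fin (n + 1) → ℙ F V, IsCoxeterTuple P Q → (∀ i, (P i).submodule ≤ W) →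
        (∀ i, (Q i).submodule ≤ W) → (∀ i : Fin n, k (Q i.succ).rep = 0) → φ P Q = 0)
      {P Q : Fin (n + 1) → ℙ F V} (_ : ∀ i, (P i).submodule ≤ W) (_ : ∀ i, (Q i).submodule ≤ W),
      φ P Q = 0)
    (hvan : ∀ P Q : Fin (n + 1) → ℙ F V,
      IsCoxeterTuple (Fin.cons x P : Fin (n + 2) → ℙ F V) (Fin.cons x Q) →
      (∀ i, (P i).submodule ≤ W) → (∀ i, (Q i).submodule ≤ W) →
      (∀ i, k (Q i).rep = 0) → φ (Fin.cons x P) (Fin.cons x Q) = 0)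
    {P Q : Fin (n + 1) → ℙ F V} (hP : ∀ i, (P i).submodule ≤ W) (hQ : ∀ i, (Q i).submodule ≤ W)
    (hPh : ∀ i, h (P i).rep = 0) (hQk : ∀ i, k (Q i).rep = 0) :
    φ (Fin.cons x P) (Fin.cons x Q) = 0 := by
  have hhx0 : h x.rep ≠ 0 := by rw [hhx]; exact one_ne_zero
  have hkx0 : k x.rep ≠ 0 := by rw [hkx]; exact one_ne_zero
  have hxW := submodule_le_iff.1 hx
  -- The transvection v ↦ v + (h - k)(v) x pulls k back to h because k(x) = 1, hence takes `ker h`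
  -- to `ker k`. Its inverse uses k - h.
  have hf : (h - k) x.rep = 0 := by simp [hhx, hkx]
  have hf' : (k - h) x.rep = 0 := by simp [hhx, hkx]
  have hsub : ∀ {f : Module.Dual F V} (hf : f x.rep = 0) {p : ℙ F V}, p.submodule ≤ W →
      (Projectivization.map (LinearEquiv.transvection hf).toLinearMap
        (LinearEquiv.transvection hf).injective p).submodule ≤ W := by
    intro f hf p hp
    refine (map_transvection_le hf p).trans (sup_le ?_ hp)
    rwa [← Projectivization.submodule_eq]
  have hkg : ∀ v, k (LinearEquiv.transvection hf v) = h v := by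
    intro v
    rw [LinearEquiv.transvection.apply]
    simp [hkx]
  have hkg' : ∀ v, h (LinearEquiv.transvection hf' v) = k v := by
    intro v
    rw [LinearEquiv.transvection.apply]
    simp [hhx]
  have hinv : ∀ v, LinearEquiv.transvection hf (LinearEquiv.transvection hf' v) = v := by
    intro v
    rw [LinearEquiv.transvection.apply, LinearEquiv.transvection.apply]
    simp only [map_add, map_smul, hf, LinearMap.sub_apply, smul_eq_mul, mul_zero, add_zero]
    module
  have hQeq : Q = Projectivization.map (LinearEquiv.transvection hf).toLinearMap
      (LinearEquiv.transvection hf).injective ∘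
      (Projectivization.map (LinearEquiv.transvection hf').toLinearMap
      (LinearEquiv.transvection hf').injective ∘ Q) := by
    funext i
    refine Projectivization.submodule_injective ?_
    simp only [Function.comp_apply, submodule_map, ← Submodule.map_comp]
    rw [show (LinearEquiv.transvection hf).toLinearMap ∘ₗ (LinearEquiv.transvection hf').toLinearMap
      = LinearMap.id from LinearMap.ext hinv, Submodule.map_id]
  rw [hQeq]
  -- The induction takes place in `W ⊓ ker h`, with the second tuple read through the transvection.
  -- Since the later points of Q' also lie in `ker k`, they are fixed.
  refine ih ((hφ.cons x x).comp_map_right (LinearEquiv.transvection hf))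
    (finrank_inf_ker hW hxW hhx0) k (fun P' Q' hPQ hP' hQ' hk' => ?_)
    (fun i => le_inf (hP i) (dual_rep_eq_zero_iff.1 (hPh i)))
    (fun i => le_inf (hsub hf' (hQ i)) (dual_rep_eq_zero_iff.1 (dual_map_rep_eq_zero hkg' (hQk i))))
  have hh : ∀ i, h (Q' i).rep = 0 := fun i => dual_rep_eq_zero_iff.2 ((hQ' i).trans inf_le_right)
  have hgk := fun i => dual_map_rep_eq_zero hkg (hh i)
  refine hvan _ _ ?_ (fun i => (hP' i).trans inf_le_left)
    (fun i => hsub hf ((hQ' i).trans inf_le_left)) hgk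
  refine hPQ.cons (fun i => dual_rep_eq_zero_iff.2 ((hP' i).trans inf_le_right)) hgk
    ((independent_map_iff _).2 hPQ.right_independent) hhx0 hkx0 ?_ fun i => ?_
  · rw [Projectivization.submodule_eq x]
    exact map_transvection_le hf _
  · exact map_transvection_eq hf (by simp [hh, hk'])

theorem exists_dual_ne_zero {n : ℕ} [FiniteDimensional F V] {W : Submodule F V}
    (hW : Module.finrank F W = n + 1) : ∃ (k : Module.Dual F V) (w : V), w ∈ W ∧ k w ≠ 0 := by
  obtain ⟨x, hx⟩ := exists_point_le hW
  obtain ⟨f, hf, -⟩ := Submodule.exists_le_ker_of_notMem (p := (⊥ : Submodule F V)) (v := x.rep)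
    (by simpa using x.rep_nonzero)
  exact ⟨f, x.rep, submodule_le_iff.1 hx, hf⟩

/-- A bimodular symbol on `W` that vanishes on Coxeter tuples `P, Q` such that all points of `Q` but
the first lie on a given hyperplane is zero on `W`. -/
theorem IsBimodularSymbol.eq_zero_of_coxeter_hyperplane [FiniteDimensional F V] {n : ℕ} :
    ∀ {φ : (Fin (n + 1) → ℙ F V) → (Fin (n + 1) → ℙ F V) → M} (_ : IsBimodularSymbol φ)
      {W : Submodule F V} (_ : Module.finrank F W = n + 1) (k : Module.Dual F V)
      (_ : ∀ P Q : Fin (n + 1) → ℙ F V, IsCoxeterTuple P Q → (∀ i, (P i).submodule ≤ W) →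
        (∀ i, (Q i).submodule ≤ W) → (∀ i : Fin n, k (Q i.succ).rep = 0) → φ P Q = 0)
      {P Q : Fin (n + 1) → ℙ F V} (_ : ∀ i, (P i).submodule ≤ W) (_ : ∀ i, (Q i).submodule ≤ W),
      φ P Q = 0 := by
  induction n with
  | zero =>
    intro φ hφ W hW k h P Q hP hQ
    refine h P Q ⟨independent_fin_one P, independent_fin_one Q, fun i _ => ?_, fun i j hij => ?_⟩
      hP hQ fun i => i.elim0
    · exact eq_of_finrank_eq_one hW (hP i) (hQ i)
    · omega
  | succ n ih =>
    intro φ hφ W hW k h P Q hP hQ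
    -- If k vanishes on W it imposes no condition and any other functional may replace it. This case
    -- must be allowed: the induction restricts k to `ker h`, where it is zero if h and k agree on
    -- W.
    wlog hk : ∃ w ∈ W, k w ≠ 0 generalizing k
    · push Not at hk
      obtain ⟨k', w, hw, hkw⟩ := exists_dual_ne_zero hW
      exact this k' (fun P' Q' hPQ hP' hQ' _ => h P' Q' hPQ hP' hQ'
        fun i => hk _ (submodule_le_iff.1 (hQ' _))) ⟨w, hw, hkw⟩
    obtain ⟨w, hw, hkw⟩ := hk
    refine (hφ.right P).eq_zero_of_hyperplane hW hw hkw (fun x Q' hx hkx hQ' => ?_) hQ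
    refine (hφ.left _).eq_zero_of_cons hW hx (fun P' hP' => ?_) hP
    by_cases hind : Independent (Fin.cons x P' : Fin (n + 2) → ℙ F V)
    swap
    · exact (hφ.left _).degenerate _ hind
    obtain ⟨f, hfx, hfP⟩ := exists_dual_of_independent_cons hind
    have hQk : ∀ i, k (Q' i).rep = 0 := fun i =>
      dual_rep_eq_zero_iff.2 ((hQ' i).trans inf_le_right)
    -- Rescaling keeps the hyperplane and gives the value 1 at x that the transvection needs.
    refine hφ.cons_eq_zero (k := (k x.rep)⁻¹ • k) hW hx hfx (by simp [hkx]) ih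
      (fun P'' Q'' hPQ hP'' hQ'' hk'' => ?_) hP' (fun i => (hQ' i).trans inf_le_left) hfP
      (fun i => by simp [hQk])
    refine h _ _ hPQ (fun i => Fin.cases hx hP'' i) (fun i => Fin.cases hx hQ'' i) fun i => ?_
    simpa [hkx] using hk'' i

/-- A bimodular symbol on `W` that vanishes on Coxeter tuples starting with a given point is zero
on `W`. -/
theorem IsBimodularSymbol.eq_zero_of_coxeter_point [FiniteDimensional F V] {n : ℕ}
    {φ : (Fin (n + 1) → ℙ F V) → (Fin (n + 1) → ℙ F V) → M} (hφ : IsBimodularSymbol φ)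
    {W : Submodule F V} (hW : Module.finrank F W = n + 1) {x : ℙ F V} (hx : x.submodule ≤ W)
    (h : ∀ P Q : Fin (n + 1) → ℙ F V, IsCoxeterTuple P Q → P 0 = x → Q 0 = x → φ P Q = 0)
    {P Q : Fin (n + 1) → ℙ F V} (hP : ∀ i, (P i).submodule ≤ W) (hQ : ∀ i, (Q i).submodule ≤ W) :
    φ P Q = 0 := by
  rcases n with _ | n
  · refine h P Q ⟨independent_fin_one P, independent_fin_one Q, fun i _ => ?_, fun i j hij => ?_⟩
      (eq_of_finrank_eq_one hW (hP 0) hx) (eq_of_finrank_eq_one hW (hQ 0) hx)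
    · exact eq_of_finrank_eq_one hW (hP i) (hQ i)
    · omega
  refine (hφ.left Q).eq_zero_of_cons hW hx (fun P' hP' => ?_) hP
  refine (hφ.right _).eq_zero_of_cons hW hx (fun Q' hQ' => ?_) hQ
  by_cases hindP : Independent (Fin.cons x P' : Fin (n + 2) → ℙ F V)
  swap
  · exact (hφ.left _).degenerate _ hindP
  by_cases hindQ : Independent (Fin.cons x Q' : Fin (n + 2) → ℙ F V)
  swap
  · exact (hφ.right _).degenerate _ hindQ
  obtain ⟨f, hfx, hfP⟩ := exists_dual_of_independent_cons hindP
  obtain ⟨k, hkx, hkQ⟩ := exists_dual_of_independent_cons hindQ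
  exact hφ.cons_eq_zero hW hx hfx hkx (fun h => h.eq_zero_of_coxeter_hyperplane)
    (fun P'' Q'' hPQ _ _ _ => h _ _ hPQ rfl rfl) hP' hQ' hfP hkQ

/-! ### Permutations of `Fin (n + 1)` with a given last value -/

/-- The permutation of `Fin (n + 1)` sending the last element to `i` and given by `τ` on the others,
through the order isomorphism of `Fin n` with the complement of `i`. -/
def permLast {n : ℕ} (i : Fin (n + 1)) (τ : Equiv.Perm (Fin n)) : Equiv.Perm (Fin (n + 1)) :=
  Fin.cycleIcc i (Fin.last n) * (finSuccEquivLast.symm.permCongr τ.optionCongr)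

theorem permLast_castSucc {n : ℕ} (i : Fin (n + 1)) (τ : Equiv.Perm (Fin n)) (j : Fin n) :
    permLast i τ j.castSucc = i.succAbove (τ j) := by
  have := congrFun (Fin.cycleIcc_comp_succAbove i (Fin.last n) i.le_last) (τ j)
  simpa [permLast, Equiv.permCongr_apply] using this

theorem permLast_last {n : ℕ} (i : Fin (n + 1)) (τ : Equiv.Perm (Fin n)) :
    permLast i τ (Fin.last n) = i := by
  simp [permLast, Equiv.permCongr_apply, Fin.cycleIcc_of_last i.le_last]

/-- The cycle moving the last place to i has sign (-1)^(n - i); the exponent n + i has the same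
parity and avoids truncated subtraction. -/
theorem sign_permLast {n : ℕ} (i : Fin (n + 1)) (τ : Equiv.Perm (Fin n)) :
    Equiv.Perm.sign (permLast i τ) = (-1) ^ (n + i : ℕ) * Equiv.Perm.sign τ := by
  rw [permLast, Equiv.Perm.sign_mul, Equiv.Perm.sign_permCongr, Equiv.optionCongr_sign,
    Fin.sign_cycleIcc_of_le i.le_last, Fin.val_last]
  congr 1
  have := i.is_le
  rw [show n + (i : ℕ) = (n - i) + 2 * i by omega, pow_add, pow_mul]
  simp

theorem permLast_bijective {n : ℕ} :
    Function.Bijective fun p : Fin (n + 1) × Equiv.Perm (Fin n) => permLast p.1 p.2 := by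
  rw [Fintype.bijective_iff_injective_and_card]
  constructor
  · rintro ⟨i, τ⟩ ⟨i', τ'⟩ h
    have hi : i = i' := by
      have := congrArg (fun σ : Equiv.Perm (Fin (n + 1)) => σ (Fin.last n)) h
      simpa [permLast_last] using this
    subst hi
    refine Prod.ext rfl (Equiv.ext fun j => ?_)
    have := congrArg (fun σ : Equiv.Perm (Fin (n + 1)) => σ j.castSucc) h
    simpa [permLast_castSucc] using this
  · simp [Fintype.card_perm, Nat.factorial_succ]

theorem sum_perm_eq_sum_permLast {n : ℕ} {M : Type*} [AddCommMonoid M]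
    (f : Equiv.Perm (Fin (n + 1)) → M) : ∑ σ, f σ = ∑ i, ∑ τ, f (permLast i τ) := by
  rw [← Fintype.sum_prod_type', ← permLast_bijective.sum_comp f]

/-! ### The double boundary of a tuple -/

/-- This is ∂∂ = 0: the same two entries can be removed in either order, with opposite signs. -/
theorem sum_removeNth_removeNth {α M : Type*} [AddCommGroup M] {n : ℕ} (a : (Fin n → α) → M)
    (P : Fin (n + 2) → α) :
    ∑ i : Fin (n + 2), ∑ j : Fin (n + 1),
      ((-1 : ℤ) ^ (i : ℕ) * (-1) ^ (j : ℕ)) • a (j.removeNth (i.removeNth P)) = 0 := by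
  rw [← Fintype.sum_prod_type']
  refine Finset.sum_involution (fun p _ => (p.1.succAbove p.2, p.2.predAbove p.1)) ?_ ?_ ?_ ?_
  · rintro ⟨i, j⟩ -
    rw [← pow_add, ← pow_add, Fin.neg_one_pow_succAbove_add_predAbove,
      ← Fin.removeNth_removeNth_eq_swap, pow_add]
    simp
  · rintro ⟨i, j⟩ - - h
    exact Fin.succAbove_ne i j (congrArg Prod.fst h)
  · intros; exact Finset.mem_univ _
  · rintro ⟨i, j⟩ -
    exact Prod.ext (Fin.succAbove_succAbove_predAbove i j)
      (Fin.predAbove_predAbove_succAbove i j)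

/-! ### Apartment chains of arbitrary tuples of points -/

variable (F V) in
/-- Chains of sequences of subspaces. -/
abbrev FlagChains : Type _ := (ℕ → Submodule F V) →₀ ℚ

/-- The sequence of the spans of `P_σ(1), …, P_σ(k)`, for `k = 0, 1, …`. -/
def flagOf {n : ℕ} (P : Fin n → ℙ F V) (σ : Equiv.Perm (Fin n)) (k : ℕ) : Submodule F V :=
  face P (σ '' {j : Fin n | (j : ℕ) < k})

/-- The alternating sum over all permutations of the flags spanned by a tuple of points. -/
def tupleChain {n : ℕ} (P : Fin n → ℙ F V) : FlagChains F V :=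
  ∑ σ : Equiv.Perm (Fin n), Finsupp.single (flagOf P σ) ((Equiv.Perm.sign σ : ℤ) : ℚ)

/-- Replace the terms from the `m`th on of a sequence of subspaces by `W`. -/
def truncate (m : ℕ) (W : Submodule F V) (x : ℕ → Submodule F V) (k : ℕ) : Submodule F V :=
  if k < m then x k else W

theorem face_image {m n : ℕ} (P : Fin n → ℙ F V) (f : Fin m → Fin n) (s : Set (Fin m)) :
    face P (f '' s) = face (P ∘ f) s :=
  iSup_image

theorem flagOf_permLast {n : ℕ} (P : Fin (n + 1) → ℙ F V) (i : Fin (n + 1))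
    (τ : Equiv.Perm (Fin n)) :
    flagOf P (permLast i τ) = truncate (n + 1) (face P Set.univ) (flagOf (i.removeNth P) τ) := by
  funext k
  rw [truncate]
  split_ifs with hk
  · rw [flagOf, flagOf, show i.removeNth P = P ∘ i.succAbove from rfl, ← face_image]
    congr 1
    ext l
    simp only [Set.mem_image, Set.mem_ofPred_eq, exists_exists_and_eq_and]
    constructor
    · rintro ⟨j, hj, rfl⟩
      have hjn : (j : ℕ) < n := by omega
      exact ⟨⟨j, hjn⟩, hj, (permLast_castSucc i τ ⟨j, hjn⟩).symm⟩
    · rintro ⟨j, hj, rfl⟩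
      exact ⟨j.castSucc, hj, permLast_castSucc i τ j⟩
  · rw [flagOf]
    congr 1
    rw [Set.eq_univ_iff_forall]
    intro l
    exact ⟨(permLast i τ).symm l, by simp only [Set.mem_ofPred_eq]; omega, by simp⟩

/-- Group the permutations by their last value i: the flags so obtained are those of the tuple
without `P i`, continued by the full span. -/
theorem tupleChain_succ {n : ℕ} (P : Fin (n + 1) → ℙ F V) :
    tupleChain P = Finsupp.lmapDomain ℚ ℚ (truncate (n + 1) (face P Set.univ))
      ((-1 : ℤ) ^ n • ∑ i : Fin (n + 1), (-1 : ℤ) ^ (i : ℕ) • tupleChain (i.removeNth P)) := by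
  rw [tupleChain, sum_perm_eq_sum_permLast, map_zsmul, map_sum, Finset.smul_sum]
  refine Finset.sum_congr rfl fun i _ => ?_
  rw [map_zsmul, smul_smul, ← pow_add, tupleChain, map_sum, Finset.smul_sum]
  refine Finset.sum_congr rfl fun τ _ => ?_
  rw [flagOf_permLast, sign_permLast, Finsupp.lmapDomain_apply, Finsupp.mapDomain_single,
    Finsupp.smul_single]
  congr 1
  simp

/-- If the removed point were outside the span of the others, putting it back would keep the tuple
independent. -/
theorem face_removeNth_eq {n : ℕ} {P : Fin (n + 1) → ℙ F V} (hP : ¬ Independent P)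
    {i : Fin (n + 1)} (hi : Independent (i.removeNth P)) :
    face (i.removeNth P) Set.univ = face P Set.univ := by
  refine le_antisymm ?_ (iSup₂_le fun j _ => ?_)
  · exact iSup₂_le fun j _ => le_iSup₂_of_le (i.succAbove j) (Set.mem_univ _) le_rfl
  by_cases hj : j = i
  swap
  · obtain ⟨l, rfl⟩ := Fin.exists_succAbove_eq hj
    exact le_iSup₂_of_le l (Set.mem_univ _) le_rfl
  subst hj
  rw [submodule_le_iff]
  by_contra hmem
  obtain ⟨k, hk, hle⟩ := Submodule.exists_le_ker_of_notMem hmem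
  have hind := independent_cons hi (fun l => dual_rep_eq_zero_iff.2
    ((le_iSup₂_of_le l (Set.mem_univ l) le_rfl : _ ≤ face _ _).trans hle)) hk
  refine hP ?_
  have := independent_comp hind j.cycleRange.injective
  rwa [Fin.cons_comp_cycleRange, Fin.insertNth_self_removeNth] at this

/-- Expand each face by `tupleChain_succ`. Independent faces all have the span of P; for a dependent
face the inner sum vanishes by induction, so the same truncation may be used there too. What remains
is the truncation of a double boundary. -/
theorem sum_tupleChain_removeNth {n : ℕ} {P : Fin (n + 1) → ℙ F V} (hP : ¬ Independent P) :
    ∑ i : Fin (n + 1), (-1 : ℤ) ^ (i : ℕ) • tupleChain (i.removeNth P) = 0 := by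
  induction n with
  | zero => exact absurd (independent_fin_one P) hP
  | succ n ih =>
    have key : ∀ i : Fin (n + 2), tupleChain (i.removeNth P) =
        Finsupp.lmapDomain ℚ ℚ (truncate (n + 1) (face P Set.univ))
          ((-1 : ℤ) ^ n • ∑ j : Fin (n + 1),
            (-1 : ℤ) ^ (j : ℕ) • tupleChain (j.removeNth (i.removeNth P))) := by
      intro i
      rw [tupleChain_succ]
      by_cases hi : Independent (i.removeNth P)
      · rw [face_removeNth_eq hP hi]
      · rw [ih hi, smul_zero, map_zero, map_zero]
    simp only [key, ← map_zsmul, ← map_sum]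
    convert! LinearMap.map_zero _
    have := sum_removeNth_removeNth (fun Q : Fin n → ℙ F V => (-1 : ℤ) ^ n • tupleChain Q) P
    rw [← this]
    refine Finset.sum_congr rfl fun i _ => ?_
    simp only [Finset.smul_sum, smul_smul]
    refine Finset.sum_congr rfl fun j _ => ?_
    congr 1
    ring

theorem tupleChain_eq_zero {n : ℕ} {P : Fin n → ℙ F V} (hP : ¬ Independent P) :
    tupleChain P = 0 := by
  rcases n with _ | n
  · refine absurd ?_ hP
    rw [Projectivization.independent_iff]
    exact linearIndependent_empty_type
  · rw [tupleChain_succ, sum_tupleChain_removeNth hP, smul_zero, map_zero]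

/-! ### Apartments span the cycles of full flags -/

/-- Full flags of `W`, as sequences of subspaces that are eventually equal to `W`. -/
structure IsFlag (n : ℕ) (W : Submodule F V) (x : ℕ → Submodule F V) : Prop where
  mono : Monotone x
  finrank_eq : ∀ k ≤ n, Module.finrank F (x k) = k
  eq_top : ∀ k, n ≤ k → x k = W

/-- Delete the `i`th term of a sequence of subspaces. -/
def eraseAt (i : ℕ) (x : ℕ → Submodule F V) : ℕ → Submodule F V :=
  Function.update x i ⊥

/-- Chains of full flags of `W` whose boundary is zero. -/
def flagCycles (n : ℕ) (W : Submodule F V) : Submodule ℚ (FlagChains F V) :=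
  Finsupp.supported ℚ ℚ {x | IsFlag n W x} ⊓
    ⨅ i ∈ Set.Ioo 0 n, LinearMap.ker (Finsupp.lmapDomain ℚ ℚ (eraseAt i))

theorem mem_flagCycles {n : ℕ} {W : Submodule F V} {z : FlagChains F V} :
    z ∈ flagCycles n W ↔ (∀ x, z x ≠ 0 → IsFlag n W x) ∧
      ∀ i, 0 < i → i < n → Finsupp.lmapDomain ℚ ℚ (eraseAt i) z = 0 := by
  simp only [flagCycles, Submodule.mem_inf, Submodule.mem_iInf, LinearMap.mem_ker, Set.mem_Ioo,
    and_imp]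
  refine and_congr_left' ?_
  rw [Finsupp.mem_supported]
  simp [Set.subset_def]

theorem face_le_iff {n : ℕ} {P : Fin n → ℙ F V} {s : Set (Fin n)} {W : Submodule F V} :
    face P s ≤ W ↔ ∀ i ∈ s, (P i).submodule ≤ W :=
  iSup₂_le_iff

theorem submodule_le_face {n : ℕ} (P : Fin n → ℙ F V) {s : Set (Fin n)} {i : Fin n} (hi : i ∈ s) :
    (P i).submodule ≤ face P s :=
  le_iSup₂_of_le i hi le_rfl

theorem finrank_face_range {m n : ℕ} {P : Fin n → ℙ F V} (hP : Independent P) {f : Fin m → Fin n}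
    (hf : Function.Injective f) : Module.finrank F (face P (Set.range f)) = m := by
  have h := independent_comp hP hf
  rw [Projectivization.independent_iff] at h
  have h2 := finrank_span_eq_card h
  rw [Fintype.card_fin, Submodule.span_range_eq_iSup] at h2
  have h3 : face (P ∘ f) Set.univ = ⨆ i, F ∙ (Projectivization.rep ∘ P ∘ f) i := by
    simp [face, Projectivization.submodule_eq]
  rw [← Set.image_univ, face_image, h3, h2]

theorem finrank_face_univ {n : ℕ} {P : Fin n → ℙ F V} (hP : Independent P) :
    Module.finrank F (face P Set.univ) = n := by
  rw [← Set.range_id]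
  exact finrank_face_range hP Function.injective_id

theorem face_univ_eq [FiniteDimensional F V] {n : ℕ} {P : Fin n → ℙ F V} (hP : Independent P)
    {W : Submodule F V} (hW : Module.finrank F W = n) (h : ∀ i, (P i).submodule ≤ W) :
    face P Set.univ = W :=
  Submodule.eq_of_le_of_finrank_eq (face_le_iff.2 fun i _ => h i) (by rw [finrank_face_univ hP, hW])

theorem flagOf_of_le {n : ℕ} (P : Fin n → ℙ F V) (σ : Equiv.Perm (Fin n)) {k : ℕ} (hk : n ≤ k) :
    flagOf P σ k = face P Set.univ := by
  rw [flagOf]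
  congr 1
  rw [Set.eq_univ_iff_forall]
  intro l
  exact ⟨σ.symm l, by simp only [Set.mem_ofPred_eq]; omega, by simp⟩

theorem isFlag_flagOf {n : ℕ} {P : Fin n → ℙ F V} (hP : Independent P) (σ : Equiv.Perm (Fin n)) :
    IsFlag n (face P Set.univ) (flagOf P σ) where
  mono k l hkl := by
    refine biSup_mono ?_
    rintro _ ⟨j, hj, rfl⟩
    exact ⟨j, lt_of_lt_of_le (show (j : ℕ) < k from hj) hkl, rfl⟩
  finrank_eq k hk := by
    have hs : {j : Fin n | (j : ℕ) < k} = Set.range (Fin.castLE hk) := by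
      ext j
      exact ⟨fun h => ⟨⟨j, h⟩, rfl⟩, by rintro ⟨l, rfl⟩; exact l.2⟩
    rw [flagOf, hs, ← Set.range_comp]
    exact finrank_face_range hP (σ.injective.comp (Fin.castLE_injective hk))
  eq_top k hk := flagOf_of_le P σ hk

theorem exists_flagOf_eq_of_tupleChain_ne_zero {n : ℕ} {P : Fin n → ℙ F V}
    {x : ℕ → Submodule F V} (hx : tupleChain P x ≠ 0) : ∃ σ, flagOf P σ = x := by
  by_contra! h
  refine hx ?_
  rw [tupleChain, Finsupp.finsetSum_apply]
  exact Finset.sum_eq_zero fun σ _ => Finsupp.single_eq_of_ne (h σ).symm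

/-- Exchanging the values of σ at the positions i - 1 and i alters only the i-th term of the flag
and reverses the sign, so the flags cancel in pairs once that term is erased. -/
theorem tupleChain_mem_flagCycles {n : ℕ} {P : Fin n → ℙ F V} (hP : Independent P) :
    tupleChain P ∈ flagCycles n (face P Set.univ) := by
  rw [mem_flagCycles]
  constructor
  · intro x hx
    obtain ⟨σ, rfl⟩ := exists_flagOf_eq_of_tupleChain_ne_zero hx
    exact isFlag_flagOf hP σ
  · intro i hi0 hin
    set a : Fin n := ⟨i - 1, by omega⟩ with ha
    set b : Fin n := ⟨i, hin⟩ with hb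
    have hab : a ≠ b := by simp only [ha, hb, ne_eq, Fin.mk.injEq]; omega
    have key : ∀ σ, eraseAt i (flagOf P (σ * Equiv.swap a b)) = eraseAt i (flagOf P σ) := by
      intro σ
      funext k
      rw [eraseAt, eraseAt]
      by_cases hk : k = i
      · subst hk; simp
      rw [Function.update_of_ne hk, Function.update_of_ne hk, flagOf, flagOf, Equiv.Perm.coe_mul,
        Set.image_comp]
      congr 2
      have hsub : ∀ j : Fin n, (j : ℕ) < k → ((Equiv.swap a b j : Fin n) : ℕ) < k := by
        intro j hj
        rcases eq_or_ne j a with rfl | h1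
        · rw [Equiv.swap_apply_left]
          simp only [ha, hb] at hj ⊢
          omega
        rcases eq_or_ne j b with rfl | h2
        · rw [Equiv.swap_apply_right]
          simp only [ha, hb] at hj ⊢
          omega
        · rwa [Equiv.swap_apply_of_ne_of_ne h1 h2]
      ext j
      exact ⟨by rintro ⟨j, hj, rfl⟩; exact hsub j hj,
        fun hj => ⟨_, hsub j hj, Equiv.swap_apply_self _ _ _⟩⟩
    rw [tupleChain, map_sum]
    refine Finset.sum_involution (fun σ _ => σ * Equiv.swap a b) ?_ ?_ ?_ ?_
    · intro σ _
      simp only [Finsupp.lmapDomain_apply, Finsupp.mapDomain_single, key, Equiv.Perm.sign_mul,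
        Equiv.Perm.sign_swap hab]
      rw [← Finsupp.single_add]
      simp
    · intro σ _ _ h
      exact hab (Equiv.swap_eq_one_iff.1 (mul_eq_left.1 h))
    · intro σ _
      exact Finset.mem_univ _
    · intro σ _
      rw [mul_assoc, Equiv.swap_mul_self, mul_one]

theorem lmapDomain_apply_of_unique {α β : Type*} {f : α → β} {z : α →₀ ℚ} {x : α}
    (h : ∀ y, z y ≠ 0 → f y = f x → y = x) : Finsupp.lmapDomain ℚ ℚ f z (f x) = z x := by
  classical
  rw [Finsupp.lmapDomain_apply, Finsupp.mapDomain, Finsupp.sum_apply, Finsupp.sum,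
    Finset.sum_eq_single x]
  · simp
  · intro y hy hyx
    exact Finsupp.single_eq_of_ne fun he => hyx (h y (by simpa using hy) he.symm)
  · intro hx
    simpa using hx

theorem lmapDomain_filter {α β : Type*} (f : α → β) (p : α → Prop) (q : β → Prop)
    [DecidablePred p] [DecidablePred q] (h : ∀ a, p a ↔ q (f a)) (z : α →₀ ℚ) :
    Finsupp.lmapDomain ℚ ℚ f (z.filter p) = (Finsupp.lmapDomain ℚ ℚ f z).filter q := by
  induction z using Finsupp.induction_linear with
  | zero => simp only [Finsupp.filter_zero, map_zero]
  | add z w hz hw => simp only [Finsupp.filter_add, map_add, hz, hw]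
  | single a c =>
    by_cases hp : p a
    · rw [Finsupp.filter_single_of_pos _ hp, Finsupp.lmapDomain_apply, Finsupp.mapDomain_single,
        Finsupp.filter_single_of_pos _ ((h a).1 hp)]
    · rw [Finsupp.filter_single_of_neg _ hp, map_zero, Finsupp.lmapDomain_apply,
        Finsupp.mapDomain_single, Finsupp.filter_single_of_neg _ (mt (h a).2 hp)]

theorem sup_eq_of_finrank [FiniteDimensional F V] {A B L : Submodule F V} (hAB : A ≤ B)
    (hr : Module.finrank F B = Module.finrank F A + 1) (hL : L ≤ B) (hLA : ¬ L ≤ A) :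
    A ⊔ L = B := by
  refine Submodule.eq_of_le_of_finrank_le (sup_le hAB hL) ?_
  have : A < A ⊔ L := lt_of_le_of_ne le_sup_left fun h => hLA (h ▸ le_sup_right)
  have := Submodule.finrank_lt_finrank_of_lt this
  omega

/-- A cycle of full flags all of whose hyperplanes contain a given point is zero. -/
theorem eq_zero_of_mem_flagCycles [FiniteDimensional F V] {n : ℕ} {W : Submodule F V}
    {z : FlagChains F V} (hz : z ∈ flagCycles (n + 1) W) {p : ℙ F V}
    (hp : ∀ x, z x ≠ 0 → p.submodule ≤ x n) : z = 0 := by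
  rw [mem_flagCycles] at hz
  -- Descend from the hyperplanes to dimension 0, where containing p is absurd.
  have key : ∀ m ≤ n, ∀ x, z x ≠ 0 → p.submodule ≤ x (n - m) := by
    intro m
    induction m with
    | zero => intro _; simpa using hp
    | succ m ih =>
      intro hm x hx
      by_contra hcon
      have ih := ih (by omega)
      obtain ⟨j, hj⟩ : ∃ j, n - (m + 1) = j := ⟨_, rfl⟩
      rw [hj] at hcon
      rw [show n - m = j + 1 by omega] at ih
      -- If p is in every (j+1)-st term but not in `x j`, that term is `x j ⊔ p`. Hence x is
      -- recovered from its erasure at j + 1, so its coefficient survives there and must be zero.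
      have hup : ∀ y, z y ≠ 0 → y j = x j → y (j + 1) = x j ⊔ p.submodule := by
        intro y hy hyx
        have hf := hz.1 y hy
        refine (sup_eq_of_finrank (hyx ▸ hf.mono (Nat.le_succ j)) ?_ (ih y hy) hcon).symm
        rw [hf.finrank_eq _ (by omega), ← hyx, hf.finrank_eq _ (by omega)]
      have h0 := hz.2 (j + 1) (Nat.succ_pos j) (by omega)
      refine hx ?_
      rw [← lmapDomain_apply_of_unique (f := eraseAt (j + 1)) (z := z), h0, Finsupp.zero_apply]
      intro y hy hyx
      have hne : ∀ k, k ≠ j + 1 → y k = x k := by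
        intro k hk
        have := congrFun hyx k
        rwa [eraseAt, eraseAt, Function.update_of_ne hk, Function.update_of_ne hk] at this
      funext k
      by_cases hk : k = j + 1
      · subst hk
        rw [hup y hy (hne j (by omega)), hup x hx rfl]
      · exact hne k hk
  ext x
  by_contra hx
  have h1 := Submodule.finrank_mono (key n le_rfl x hx)
  rw [Nat.sub_self, (hz.1 x hx).finrank_eq 0 (Nat.zero_le _), p.finrank_submodule] at h1
  omega

variable (F V) in
/-- The span of the apartment chains of the independent `n`-tuples of points of `W`. -/
def apartmentSpan (n : ℕ) (W : Submodule F V) : Submodule ℚ (FlagChains F V) :=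
  Submodule.span ℚ {c | ∃ P : Fin n → ℙ F V, Independent P ∧ (∀ i, (P i).submodule ≤ W) ∧
    tupleChain P = c}

theorem tupleChain_mem_apartmentSpan {n : ℕ} {W : Submodule F V} {P : Fin n → ℙ F V}
    (hP : Independent P) (hPW : ∀ i, (P i).submodule ≤ W) : tupleChain P ∈ apartmentSpan F V n W :=
  Submodule.subset_span ⟨P, hP, hPW, rfl⟩

theorem apartmentSpan_le_flagCycles [FiniteDimensional F V] {n : ℕ} {W : Submodule F V}
    (hW : Module.finrank F W = n) : apartmentSpan F V n W ≤ flagCycles n W := by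
  rw [apartmentSpan, Submodule.span_le]
  rintro _ ⟨P, hP, hPW, rfl⟩
  rw [← face_univ_eq hP hW hPW]
  exact tupleChain_mem_flagCycles hP

/-- Cone an apartment of H from p. In the expansion of the apartment of `(p, P)`, the face omitting
p gives the flags through H, and every other face contains p, so its flags have a hyperplane through
p. -/
theorem lmapDomain_truncate_mem [FiniteDimensional F V] {n : ℕ} {W H : Submodule F V}
    (hW : Module.finrank F W = n + 1) (hHW : H ≤ W) {p : ℙ F V}
    (hpW : p.submodule ≤ W) (hpH : ¬ p.submodule ≤ H) {y : FlagChains F V}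
    (hy : y ∈ apartmentSpan F V n H) :
    Finsupp.lmapDomain ℚ ℚ (truncate (n + 1) W) y ∈
      apartmentSpan F V (n + 1) W ⊔ Finsupp.supported ℚ ℚ {x | p.submodule ≤ x n} := by
  rw [apartmentSpan] at hy
  induction hy using Submodule.span_induction with
  | zero => rw [map_zero]; exact zero_mem _
  | add y y' _ _ hy hy' => rw [map_add]; exact add_mem hy hy'
  | smul c y _ hy => rw [map_smul]; exact Submodule.smul_mem _ _ hy
  | mem y hy =>
  obtain ⟨P, hP, hPH, rfl⟩ := hy
  obtain ⟨k, hk, hle⟩ := Submodule.exists_le_ker_of_notMem (fun h => hpH (submodule_le_iff.2 h))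
  have hind := independent_cons hP (fun i => dual_rep_eq_zero_iff.2 ((hPH i).trans hle)) hk
  have hPW : ∀ i, ((Fin.cons p P : Fin (n + 1) → ℙ F V) i).submodule ≤ W :=
    Fin.cases hpW fun i => (hPH i).trans hHW
  have h1 := tupleChain_succ (Fin.cons p P : Fin (n + 1) → ℙ F V)
  rw [face_univ_eq hind hW hPW, Fin.sum_univ_succ, Fin.removeNth_zero, Fin.tail_cons] at h1
  have h2 : Finsupp.lmapDomain ℚ ℚ (truncate (n + 1) W) (tupleChain P) =
      (-1 : ℤ) ^ n • tupleChain (Fin.cons p P : Fin (n + 1) → ℙ F V) -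
      Finsupp.lmapDomain ℚ ℚ (truncate (n + 1) W) (∑ i : Fin n, (-1 : ℤ) ^ (i.succ : ℕ) •
        tupleChain (i.succ.removeNth (Fin.cons p P : Fin (n + 1) → ℙ F V))) := by
    rw [h1, map_zsmul, smul_smul, ← mul_pow, neg_mul_neg, one_mul, one_pow, one_smul, map_add,
      Fin.val_zero, pow_zero, one_smul, add_sub_cancel_right]
  rw [h2]
  refine sub_mem (Submodule.mem_sup_left (zsmul_mem (tupleChain_mem_apartmentSpan hind hPW) _))
    (Submodule.mem_sup_right ?_)
  rw [map_sum]
  refine sum_mem fun i _ => ?_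
  rw [map_zsmul]
  refine zsmul_mem ?_ _
  rw [tupleChain, map_sum]
  refine sum_mem fun σ _ => ?_
  rw [Finsupp.lmapDomain_apply, Finsupp.mapDomain_single]
  refine Finsupp.single_mem_supported _ _ ?_
  rw [Set.mem_ofPred_eq, truncate, if_pos (Nat.lt_succ_self n), flagOf_of_le _ _ le_rfl]
  obtain ⟨m, rfl⟩ : ∃ m, n = m + 1 := ⟨n - 1, by have := i.pos; omega⟩
  rw [removeNth_succ_cons]
  exact submodule_le_face (Fin.cons p (i.removeNth P)) (Set.mem_univ 0)

/-! ### Residues of cycles at a hyperplane -/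

open Classical in
/-- The part of a chain of flags of `W` with hyperplane `H`, as a chain of flags of `H`. -/
def residue (n : ℕ) (H : Submodule F V) (z : FlagChains F V) : FlagChains F V :=
  Finsupp.lmapDomain ℚ ℚ (truncate n H) (z.filter fun x => x n = H)

theorem eraseAt_truncate {i n : ℕ} (hi : i < n) (H : Submodule F V) :
    eraseAt i ∘ truncate n H = truncate n H ∘ eraseAt i := by
  funext x k
  simp only [Function.comp_apply, eraseAt, truncate, Function.update_apply]
  split_ifs <;> first | rfl | omega

/-- Erasing a term below n commutes with selecting the hyperplane and with truncating, so these
cycle conditions pass to the residue. -/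
theorem residue_mem_flagCycles {n : ℕ} {W H : Submodule F V} {z : FlagChains F V}
    (hz : z ∈ flagCycles (n + 1) W) : residue n H z ∈ flagCycles n H := by
  classical
  rw [mem_flagCycles] at hz ⊢
  constructor
  · intro y hy
    obtain ⟨x, hx, rfl⟩ : ∃ x ∈ (z.filter fun x => x n = H).support, truncate n H x = y := by
      have := Finsupp.mapDomain_support (Finsupp.mem_support_iff.2 hy)
      simpa using this
    rw [Finsupp.support_filter, Finset.mem_filter, Finsupp.mem_support_iff] at hx
    have hf := hz.1 x hx.1
    have hx2 := hx.2
    refine ⟨fun k l hkl => ?_, fun k hk => ?_, fun k hk => ?_⟩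
    · simp only [truncate]
      split_ifs with h1 h2 h2
      · exact hf.mono hkl
      · exact hx2 ▸ hf.mono (by omega)
      · omega
      · exact le_rfl
    · rw [show truncate n H x k = x k from ?_]
      · exact hf.finrank_eq k (by omega)
      · rw [truncate]
        split_ifs with h1
        · rfl
        · obtain rfl : k = n := by omega
          exact hx2.symm
    · simp only [truncate]
      rw [if_neg (by omega)]
  · intro i hi0 hin
    rw [residue, ← LinearMap.comp_apply, ← Finsupp.lmapDomain_comp, eraseAt_truncate hin,
      Finsupp.lmapDomain_comp, LinearMap.comp_apply,
      lmapDomain_filter (eraseAt i) _ (fun x => x n = H), hz.2 i hi0 (by omega)]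
    · simp only [Finsupp.filter_zero, map_zero]
    · intro x
      rw [eraseAt, Function.update_of_ne (by omega)]

open Classical in
theorem lmapDomain_truncate_residue {n : ℕ} {W H : Submodule F V} {z : FlagChains F V}
    (hz : z ∈ flagCycles (n + 1) W) :
    Finsupp.lmapDomain ℚ ℚ (truncate (n + 1) W) (residue n H z) =
      z.filter fun x => x n = H := by
  rw [mem_flagCycles] at hz
  rw [residue, ← LinearMap.comp_apply, ← Finsupp.lmapDomain_comp, Finsupp.lmapDomain_apply]
  conv_rhs => rw [← Finsupp.mapDomain_id (v := z.filter fun x => x n = H)]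
  refine Finsupp.mapDomain_congr fun x hx => ?_
  rw [Finsupp.support_filter, Finset.mem_filter, Finsupp.mem_support_iff] at hx
  funext k
  simp only [Function.comp_apply, truncate, id]
  split_ifs with h1 h2
  · rfl
  · obtain rfl : k = n := by omega
    exact hx.2.symm
  · exact ((hz.1 x hx.1).eq_top k (by omega)).symm

theorem flagCycles_le_apartmentSpan [FiniteDimensional F V] {n : ℕ} {W : Submodule F V}
    (hW : Module.finrank F W = n) : flagCycles n W ≤ apartmentSpan F V n W := by
  classical
  induction n generalizing W with
  | zero =>
    intro z hz
    rw [mem_flagCycles] at hz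
    have hind : Independent (Fin.elim0 : Fin 0 → ℙ F V) := by
      rw [Projectivization.independent_iff]
      exact linearIndependent_empty_type
    have hface : face (Fin.elim0 : Fin 0 → ℙ F V) Set.univ = W :=
      face_univ_eq hind hW fun i => i.elim0
    have hz2 : z = z (fun _ => W) • tupleChain (Fin.elim0 : Fin 0 → ℙ F V) := by
      have hflag : flagOf (Fin.elim0 : Fin 0 → ℙ F V) 1 = fun _ => W := by
        funext k
        rw [flagOf_of_le _ _ (Nat.zero_le k), hface]
      rw [tupleChain, Fintype.sum_unique, show (default : Equiv.Perm (Fin 0)) = 1 from rfl, hflag,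
        Finsupp.smul_single]
      ext x
      by_cases hx : z x = 0
      · by_cases hxW : x = fun _ => W
        · subst hxW; simp
        · rw [hx, Finsupp.single_eq_of_ne hxW]
      · obtain rfl : x = fun _ => W := funext fun k => (hz.1 x hx).eq_top k (Nat.zero_le k)
        simp
    rw [hz2]
    exact Submodule.smul_mem _ _ (tupleChain_mem_apartmentSpan hind fun i => i.elim0)
  | succ n ih =>
    intro z hz
    obtain ⟨p, hp⟩ := exists_point_le hW
    have hsum : z = ∑ H ∈ z.support.image (fun x => x n), z.filter fun x => x n = H := by
      ext x
      rw [Finsupp.finsetSum_apply]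
      simp only [Finsupp.filter_apply]
      rw [Finset.sum_ite_eq]
      split_ifs with h
      · rfl
      · by_contra hx
        exact h (Finset.mem_image_of_mem _ (Finsupp.mem_support_iff.2 hx))
    -- Hyperplanes through p contribute to the second summand. The other ones are handled by
    -- induction on their residues, followed by coning from p.
    have hmem : z ∈ apartmentSpan F V (n + 1) W ⊔
        Finsupp.supported ℚ ℚ {x | p.submodule ≤ x n} := by
      rw [hsum]
      refine sum_mem fun H hH => ?_
      obtain ⟨x, hx, rfl⟩ := Finset.mem_image.1 hH
      have hf := (mem_flagCycles.1 hz).1 x (Finsupp.mem_support_iff.1 hx)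
      by_cases hpx : p.submodule ≤ x n
      · refine Submodule.mem_sup_right ?_
        rw [Finsupp.mem_supported]
        intro y hy
        rw [Finset.mem_coe, Finsupp.support_filter, Finset.mem_filter] at hy
        exact hpx.trans hy.2.ge
      · rw [← lmapDomain_truncate_residue hz]
        exact lmapDomain_truncate_mem hW
          (hf.eq_top (n + 1) le_rfl ▸ hf.mono (Nat.le_succ n)) hp hpx
          (ih (hf.finrank_eq n (Nat.le_succ n)) (residue_mem_flagCycles hz))
    obtain ⟨s, hs, t, ht, rfl⟩ := Submodule.mem_sup.1 hmem
    have ht2 : t ∈ flagCycles (n + 1) W := by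
      have := sub_mem hz (apartmentSpan_le_flagCycles hW hs)
      rwa [add_sub_cancel_left] at this
    have ht0 : t = 0 := eq_zero_of_mem_flagCycles ht2 (p := p) fun x hx =>
      (Finsupp.mem_supported ℚ t).1 ht (Finsupp.mem_support_iff.2 hx)
    rwa [ht0, add_zero]

/-! ### Chains of the Tits building as chains of sequences of subspaces -/

/-- A flag of proper subspaces, as a sequence of subspaces starting with `0` and ending with the
whole space. -/
def padFlag {m : ℕ} (c : Fin m ↪o ProperSubspace F V) (k : ℕ) : Submodule F V :=
  if k = 0 then ⊥ else if h : k - 1 < m then (c ⟨k - 1, h⟩).1 else ⊤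

theorem padFlag_zero {m : ℕ} (c : Fin m ↪o ProperSubspace F V) : padFlag c 0 = ⊥ := by
  simp [padFlag]

theorem padFlag_succ {m : ℕ} (c : Fin m ↪o ProperSubspace F V) (j : Fin m) :
    padFlag c (j + 1) = (c j).1 := by
  simp [padFlag]

theorem padFlag_of_lt {m : ℕ} (c : Fin m ↪o ProperSubspace F V) {k : ℕ} (hk : m < k) :
    padFlag c k = ⊤ := by
  rw [padFlag, if_neg (by omega), dif_neg (by omega)]

theorem padFlag_injective {m : ℕ} :
    Function.Injective (padFlag : (Fin m ↪o ProperSubspace F V) → ℕ → Submodule F V) := by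
  intro c c' h
  ext1 j
  refine Subtype.ext ?_
  rw [← padFlag_succ, ← padFlag_succ, h]

theorem padFlag_lt_succ {m : ℕ} (c : Fin m ↪o ProperSubspace F V) {k : ℕ} (hk0 : m ≠ 0)
    (hk : k ≤ m) : padFlag c k < padFlag c (k + 1) := by
  rcases k with _ | k
  · rw [padFlag_zero, padFlag_succ c ⟨0, by omega⟩]
    exact bot_lt_iff_ne_bot.2 (c _).2.1
  · rw [padFlag_succ c ⟨k, hk⟩]
    by_cases hkm : k + 1 < m
    · rw [padFlag_succ c ⟨k + 1, hkm⟩]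
      exact c.strictMono (Nat.lt_succ_self k)
    · rw [padFlag_of_lt c (by omega)]
      exact lt_top_iff_ne_top.2 (c _).2.2

/-- Applied to the dimensions in a strict flag, which are squeezed from both ends. -/
theorem eq_self_of_lt_succ {f : ℕ → ℕ} {n : ℕ} (hf : ∀ k < n, f k < f (k + 1)) (hn : f n ≤ n)
    {k : ℕ} (hk : k ≤ n) : f k = k := by
  have h1 : ∀ j ≤ n, j ≤ f j := by
    intro j
    induction j with
    | zero => intro _; exact Nat.zero_le _
    | succ j ih => intro hj; have := ih (by omega); have := hf j (by omega); omega
  have h2 : ∀ j ≤ n, f (n - j) + j ≤ n := by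
    intro j
    induction j with
    | zero => intro _; simpa using hn
    | succ j ih =>
      intro hj
      have h3 := ih (by omega)
      have h4 := hf (n - (j + 1)) (by omega)
      rw [show n - (j + 1) + 1 = n - j by omega] at h4
      omega
  have h3 := h1 k hk
  have h4 := h2 (n - k) (by omega)
  rw [show n - (n - k) = k by omega] at h4
  omega

theorem isFlag_padFlag [FiniteDimensional F V] {n : ℕ} (hn : Module.finrank F V = n)
    (c : Fin (n - 1) ↪o ProperSubspace F V) : IsFlag n ⊤ (padFlag c) := by
  have hlt : ∀ k < n, padFlag c k < padFlag c (k + 1) := by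
    intro k hk
    by_cases h0 : n - 1 = 0
    · obtain rfl : k = 0 := by omega
      rw [padFlag_zero, padFlag_of_lt c (by omega)]
      have : Nontrivial V := Module.nontrivial_of_finrank_pos (R := F) (by omega)
      exact bot_lt_top
    · exact padFlag_lt_succ c h0 (by omega)
  have htop : ∀ k, n ≤ k → padFlag c k = ⊤ := by
    intro k hk
    by_cases hk0 : k = 0
    · subst hk0
      obtain rfl : n = 0 := by omega
      have := (Module.finrank_zero_iff (R := F) (M := V)).1 hn
      rw [padFlag_zero]
      exact Subsingleton.elim _ _
    · exact padFlag_of_lt c (by omega)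
  refine ⟨monotone_nat_of_le_succ fun k => ?_, fun k hk => ?_, htop⟩
  · by_cases hk : k < n
    · exact (hlt k hk).le
    · rw [htop (k + 1) (by omega)]
      exact le_top
  · refine eq_self_of_lt_succ (f := fun k => Module.finrank F (padFlag c k)) (fun k hk => ?_) ?_ hk
    · exact Submodule.finrank_lt_finrank_of_lt (hlt k hk)
    · exact (Submodule.finrank_le _).trans hn.le

variable (F V) in
/-- The embedding of the chains of the Tits building into the chains of sequences of subspaces. -/
def padChain (m : ℕ) : Chains (ProperSubspace F V) m →ₗ[ℚ] FlagChains F V :=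
  Finsupp.lmapDomain ℚ ℚ padFlag

theorem padChain_injective (m : ℕ) : Function.Injective (padChain F V m) :=
  Finsupp.mapDomain_injective padFlag_injective

theorem padFlag_apartmentFlag [FiniteDimensional F V] {n : ℕ} (hn : Module.finrank F V = n)
    {P : Fin n → ℙ F V} (hP : Independent P) (σ : Equiv.Perm (Fin n)) :
    padFlag (apartmentFlag P hP σ) = flagOf P σ := by
  funext k
  rcases k with _ | k
  · simp [padFlag_zero, flagOf, face]
  by_cases hk : k < n - 1
  · rw [padFlag_succ _ ⟨k, hk⟩]
    change face P (σ '' {j : Fin n | (j : ℕ) ≤ k}) = face P (σ '' {j : Fin n | (j : ℕ) < k + 1})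
    simp only [Nat.lt_succ_iff]
  · rw [padFlag_of_lt _ (by omega), flagOf_of_le _ _ (by omega),
      face_univ_eq hP (W := ⊤) (by rw [finrank_top, hn]) fun _ => le_top]

theorem padChain_apartmentChain [FiniteDimensional F V] {n : ℕ} (hn : Module.finrank F V = n)
    {P : Fin n → ℙ F V} (hP : Independent P) :
    padChain F V (n - 1) (apartmentChain P hP) = tupleChain P := by
  rw [apartmentChain, map_sum, tupleChain]
  refine Finset.sum_congr rfl fun σ _ => ?_
  rw [padChain, Finsupp.lmapDomain_apply, Finsupp.mapDomain_single, padFlag_apartmentFlag hn]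

/-- A flag of proper subspaces, as a sequence of subspaces indexed by the dimension. -/
def dimFlag {m : ℕ} (N : ℕ) (c : Fin m ↪o ProperSubspace F V) (k : ℕ) : Submodule F V :=
  if k < N then ⨆ (j : Fin m) (_ : Module.finrank F (c j).1 = k), (c j).1 else ⊤

/-- Dimensions record positions in the full flag, so a deleted vertex leaves an empty supremum at
exactly its own index. -/
theorem dimFlag_succAbove [FiniteDimensional F V] {m : ℕ} (hn : Module.finrank F V = m + 2)
    (c : Fin (m + 1) ↪o ProperSubspace F V) (i : Fin (m + 1)) :
    dimFlag (m + 2) ((Fin.succAboveOrderEmb i).trans c) = eraseAt (i + 1) (padFlag c) := by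
  have hdim : ∀ j, Module.finrank F (c j).1 = j + 1 := by
    intro j
    rw [← padFlag_succ c j]
    exact (isFlag_padFlag hn c).finrank_eq _ (by omega)
  funext k
  rw [dimFlag, eraseAt]
  split_ifs with hk
  · by_cases hki : k = i + 1
    · subst hki
      rw [Function.update_self, iSup_eq_bot]
      intro j
      rw [iSup_eq_bot]
      intro hj
      have h1 : ((i.succAbove j : Fin (m + 1)) : ℕ) + 1 = i + 1 := (hdim _).symm.trans hj
      exact absurd (Fin.ext (by omega)) (Fin.succAbove_ne i j)
    rw [Function.update_of_ne hki]
    rcases k with _ | k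
    · rw [padFlag_zero, iSup_eq_bot]
      intro j
      rw [iSup_eq_bot]
      intro hj
      have h1 : ((i.succAbove j : Fin (m + 1)) : ℕ) + 1 = 0 := (hdim _).symm.trans hj
      omega
    · obtain ⟨l, hl⟩ := Fin.exists_succAbove_eq (x := (⟨k, by omega⟩ : Fin (m + 1))) (y := i)
        (by rintro rfl; exact hki rfl)
      rw [padFlag_succ c ⟨k, by omega⟩, ← hl]
      refine le_antisymm (iSup₂_le fun j hj => ?_) (le_iSup₂_of_le l ?_ le_rfl)
      · have h1 : ((i.succAbove j : Fin (m + 1)) : ℕ) + 1 = k + 1 := (hdim _).symm.trans hj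
        rw [hl, ← show i.succAbove j = ⟨k, by omega⟩ from Fin.ext (by simpa using h1)]
        exact le_rfl
      · have h1 := hdim (i.succAbove l)
        rw [hl] at h1
        change Module.finrank F (c (i.succAbove l)).1 = k + 1
        rw [hl]
        exact h1
  · rw [Function.update_of_ne (by omega), padFlag_of_lt _ (by omega)]

theorem lmapDomain_dimFlag_boundary [FiniteDimensional F V] {m : ℕ}
    (hn : Module.finrank F V = m + 2) (z : Chains (ProperSubspace F V) (m + 1)) :
    Finsupp.lmapDomain ℚ ℚ (dimFlag (m + 2)) (boundary (ProperSubspace F V) m z) =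
      ∑ i : Fin (m + 1), (-1 : ℚ) ^ (i : ℕ) •
        Finsupp.lmapDomain ℚ ℚ (eraseAt (i + 1)) (padChain F V (m + 1) z) := by
  induction z using Finsupp.induction_linear with
  | zero => simp only [map_zero, smul_zero, Finset.sum_const_zero]
  | add z w hz hw => simp only [map_add, hz, hw, smul_add, Finset.sum_add_distrib]
  | single c a =>
    rw [boundary, Finsupp.lsum_single, LinearMap.sum_apply, map_sum]
    refine Finset.sum_congr rfl fun i _ => ?_
    rw [LinearMap.smul_apply, map_smul, Finsupp.lsingle_apply, padChain, Finsupp.lmapDomain_apply,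
      Finsupp.lmapDomain_apply, Finsupp.lmapDomain_apply, Finsupp.mapDomain_single,
      Finsupp.mapDomain_single, Finsupp.mapDomain_single, dimFlag_succAbove hn]

/-- The boundary is an alternating sum of erasures. Their supports are disjoint, since the position
of ⊥ in positive degree reveals which term was erased; hence each erasure vanishes separately. -/
theorem padChain_mem_flagCycles [FiniteDimensional F V] {n : ℕ} (hn : Module.finrank F V = n)
    {z : Chains (ProperSubspace F V) (n - 1)} (hz : z ∈ cycles (ProperSubspace F V) (n - 1)) :
    padChain F V (n - 1) z ∈ flagCycles n ⊤ := by
  classical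
  rw [mem_flagCycles]
  have hflag : ∀ x, padChain F V (n - 1) z x ≠ 0 → IsFlag n ⊤ x := by
    intro x hx
    have := Finsupp.mapDomain_support (Finsupp.mem_support_iff.2 hx)
    obtain ⟨c, -, rfl⟩ := Finset.mem_image.1 this
    exact isFlag_padFlag hn c
  refine ⟨hflag, fun i hi0 hin => ?_⟩
  obtain ⟨m, rfl⟩ : ∃ m, n = m + 2 := ⟨n - 2, by omega⟩
  have h0 := lmapDomain_dimFlag_boundary hn z
  rw [show boundary (ProperSubspace F V) m z = 0 from hz, map_zero] at h0
  have hsupp : ∀ (j : ℕ) (y : ℕ → Submodule F V),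
      Finsupp.lmapDomain ℚ ℚ (eraseAt j) (padChain F V (m + 1) z) y ≠ 0 →
      y j = ⊥ ∧ ∀ k, 0 < k → k < m + 2 → k ≠ j → y k ≠ ⊥ := by
    intro j y hy
    have := Finsupp.mapDomain_support (Finsupp.mem_support_iff.2 hy)
    obtain ⟨x, hx, rfl⟩ := Finset.mem_image.1 this
    have hf := hflag x (Finsupp.mem_support_iff.1 hx)
    refine ⟨by simp [eraseAt], fun k hk0 hk hkj h => ?_⟩
    rw [eraseAt, Function.update_of_ne hkj] at h
    have h2 := hf.finrank_eq k hk.le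
    rw [h, finrank_bot] at h2
    omega
  obtain ⟨l, rfl⟩ : ∃ l : Fin (m + 1), i = l + 1 := ⟨⟨i - 1, by omega⟩, by simp; omega⟩
  ext y
  by_contra hy
  have hy' := hsupp _ _ hy
  have h1 := DFunLike.congr_fun h0 y
  rw [Finsupp.finsetSum_apply, Finset.sum_eq_single l] at h1
  · rw [Finsupp.smul_apply, Finsupp.zero_apply, eq_comm, smul_eq_zero] at h1
    exact h1.elim (pow_ne_zero _ (by norm_num)) hy
  · intro j _ hjl
    rw [Finsupp.smul_apply, smul_eq_zero]
    right
    by_contra hj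
    exact (hsupp _ _ hj).2 (l + 1) (by omega) (by omega)
      (fun h => hjl (Fin.ext (by omega))) hy'.1
  · intro h
    exact absurd (Finset.mem_univ l) h

/-! ### The Steinberg module -/

variable (F V) in
/-- The embedding of the cycles of degree `dim V - 2` of the Tits building into the chains of
sequences of subspaces. -/
def padCycle : cycles (ProperSubspace F V) (Module.finrank F V - 1) →ₗ[ℚ] FlagChains F V :=
  padChain F V (Module.finrank F V - 1) ∘ₗ Submodule.subtype _

theorem padCycle_injective : Function.Injective (padCycle F V) :=
  (padChain_injective _).comp Subtype.val_injective

open Classical in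
/-- The cycle of the apartment of a projective simplex. -/
def apartmentCycle (P : Fin (Module.finrank F V) → ℙ F V) :
    cycles (ProperSubspace F V) (Module.finrank F V - 1) :=
  if hP : Independent P then ⟨apartmentChain P hP, apartmentChain_mem_cycles P hP⟩ else 0

theorem apartment_eq_mkQ (P : Fin (Module.finrank F V) → ℙ F V) :
    apartment P = Submodule.mkQ _ (apartmentCycle P) := by
  rw [apartment, apartmentCycle]
  split_ifs
  · rfl
  · rw [map_zero]

theorem padCycle_apartmentCycle [FiniteDimensional F V] (P : Fin (Module.finrank F V) → ℙ F V) :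
    padCycle F V (apartmentCycle P) = tupleChain P := by
  rw [apartmentCycle]
  split_ifs with hP
  · exact padChain_apartmentChain rfl hP
  · rw [map_zero, tupleChain_eq_zero hP]

/-- The relation already holds between cycles, before passing to homology. -/
theorem isModularSymbol_apartment [FiniteDimensional F V] :
    IsModularSymbol (apartment : (Fin (Module.finrank F V) → ℙ F V) → Steinberg F V) where
  degenerate P hP := dif_neg hP
  relation P hP := by
    simp only [apartment_eq_mkQ, ← map_zsmul, ← map_sum]
    convert! LinearMap.map_zero _
    apply padCycle_injective
    simp only [map_sum, map_zsmul, padCycle_apartmentCycle, map_zero]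
    exact sum_tupleChain_removeNth hP

/-- The apartment classes span the Steinberg module. -/
theorem span_range_apartment [FiniteDimensional F V] :
    Submodule.span ℚ (Set.range (apartment : (Fin (Module.finrank F V) → ℙ F V) → Steinberg F V)) =
      ⊤ := by
  have h1 : Submodule.span ℚ (Set.range (apartmentCycle (F := F) (V := V))) = ⊤ := by
    rw [eq_top_iff]
    intro z _
    have hz : padCycle F V z ∈ apartmentSpan F V (Module.finrank F V) ⊤ :=
      flagCycles_le_apartmentSpan (finrank_top F V) (padChain_mem_flagCycles rfl z.2)
    have hle : apartmentSpan F V (Module.finrank F V) ⊤ ≤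
        (Submodule.span ℚ (Set.range (apartmentCycle (F := F) (V := V)))).map (padCycle F V) := by
      rw [apartmentSpan, Submodule.span_le]
      rintro _ ⟨P, -, -, rfl⟩
      exact ⟨_, Submodule.subset_span ⟨P, rfl⟩, padCycle_apartmentCycle P⟩
    obtain ⟨w, hw, hwz⟩ := hle hz
    rwa [← padCycle_injective hwz]
  have h2 : (apartment : (Fin (Module.finrank F V) → ℙ F V) → Steinberg F V) =
      Submodule.mkQ _ ∘ apartmentCycle := funext apartment_eq_mkQ
  rw [h2, Set.range_comp, Submodule.span_image, h1, Submodule.map_top, Submodule.range_mkQ]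

/-- In the application f is the quotient map by the span of the chosen Coxeter pairs. -/
theorem isBimodularSymbol_apartment_tmul [FiniteDimensional F V] {M : Type*} [AddCommGroup M]
    [Module ℚ M] (f : Steinberg F V ⊗[ℚ] Steinberg F V →ₗ[ℚ] M) :
    IsBimodularSymbol fun P Q : Fin (Module.finrank F V) → ℙ F V =>
      f (apartment P ⊗ₜ[ℚ] apartment Q) where
  left Q :=
    { degenerate := fun P hP => by
        simp only [isModularSymbol_apartment.degenerate P hP, TensorProduct.zero_tmul, map_zero]
      relation := fun P hP => by
        have := congrArg (f ∘ₗ (TensorProduct.mk ℚ _ _).flip (apartment Q))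
          (isModularSymbol_apartment.relation P hP)
        rwa [map_sum, map_zero, Finset.sum_congr rfl fun i _ => map_zsmul _ _ _] at this }
  right P :=
    { degenerate := fun Q hQ => by
        simp only [isModularSymbol_apartment.degenerate Q hQ, TensorProduct.tmul_zero, map_zero]
      relation := fun Q hQ => by
        have := congrArg (f ∘ₗ TensorProduct.mk ℚ _ _ (apartment P))
          (isModularSymbol_apartment.relation Q hQ)
        rwa [map_sum, map_zero, Finset.sum_congr rfl fun i _ => map_zsmul _ _ _] at this }

/-- A subspace of `St(V) ⊗ St(V)` is everything if it contains all products of apartment classes. -/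
theorem eq_top_of_apartment_tmul_mem [FiniteDimensional F V]
    {S : Submodule ℚ (Steinberg F V ⊗[ℚ] Steinberg F V)}
    (h : ∀ P Q : Fin (Module.finrank F V) → ℙ F V, S.mkQ (apartment P ⊗ₜ[ℚ] apartment Q) = 0) :
    S = ⊤ := by
  rw [← S.ker_mkQ, LinearMap.ker_eq_top]
  refine TensorProduct.ext ?_
  refine LinearMap.ext_on_range span_range_apartment fun P => ?_
  exact LinearMap.ext_on_range span_range_apartment fun Q => h P Q

theorem isCoxeterPair_iff {P Q : Fin (Module.finrank F V) → ℙ F V} :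
    IsCoxeterPair P Q ↔ IsCoxeterTuple P Q :=
  ⟨fun h => ⟨h.1, h.2, h.3, h.4⟩, fun h => ⟨h.1, h.2, h.3, h.4⟩⟩

/-- A bimodular symbol on `V` that vanishes on Coxeter tuples `P, Q` such that all points of `P` but
the last lie on a given hyperplane is zero. -/
theorem IsBimodularSymbol.eq_zero_of_coxeter_le_hyperplane [FiniteDimensional F V] {M : Type*}
    [AddCommGroup M] {n : ℕ} {φ : (Fin n → ℙ F V) → (Fin n → ℙ F V) → M} (hφ : IsBimodularSymbol φ)
    (hn : Module.finrank F V = n) {H : Submodule F V}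
    (hH : Module.finrank F H + 1 = Module.finrank F V)
    (h : ∀ P Q : Fin n → ℙ F V, IsCoxeterTuple P Q →
      (∀ i : Fin n, (i : ℕ) + 1 < n → (P i).submodule ≤ H) → φ P Q = 0)
    (P Q : Fin n → ℙ F V) : φ P Q = 0 := by
  rcases n with _ | n
  · omega
  obtain ⟨k, hk0, hk⟩ := H.exists_le_ker_of_lt_top (lt_top_iff_ne_top.2 fun h => by
    rw [h, finrank_top] at hH; omega)
  obtain ⟨w, hw⟩ : ∃ w, k w ≠ 0 := by
    by_contra! hcon
    exact hk0 (LinearMap.ext hcon)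
  have hker : H = LinearMap.ker k := by
    refine Submodule.eq_of_le_of_finrank_eq hk ?_
    have := finrank_inf_ker (W := ⊤) (by rw [finrank_top, hn]) (Submodule.mem_top (x := w)) hw
    rw [top_inf_eq] at this
    omega
  -- Reversal turns "all points but the last" into "all points but the first".
  have hrev : IsBimodularSymbol fun P Q : Fin (n + 1) → ℙ F V => φ (P ∘ Fin.rev) (Q ∘ Fin.rev) :=
    ⟨fun Q => (hφ.left (Q ∘ Fin.rev)).comp_rev, fun P => (hφ.right (P ∘ Fin.rev)).comp_rev⟩
  have := hrev.eq_zero_of_revCoxeter_hyperplane (W := ⊤) (by rw [finrank_top, hn])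
    (Submodule.mem_top (x := w)) hw (fun P Q hPQ hP => h _ _ hPQ.comp_rev fun i hi => ?_)
    (P := P ∘ Fin.rev) (Q := Q ∘ Fin.rev) (fun _ => le_top) (fun _ => le_top)
  · simpa only [Function.comp_assoc, Fin.rev_involutive.comp_self, Function.comp_id] using this
  · rw [hker, Function.comp_apply, ← dual_rep_eq_zero_iff]
    obtain ⟨j, hj⟩ : ∃ j : Fin n, j.succ = i.rev :=
      Fin.exists_succ_eq_of_ne_zero fun h0 => by
        have := congrArg Fin.val h0
        rw [Fin.val_rev] at this
        simp at this
        omega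
    rw [← hj]
    exact hP j

/-- A bimodular symbol on `V` that vanishes on Coxeter tuples starting with a given line is zero. -/
theorem IsBimodularSymbol.eq_zero_of_coxeter_line [FiniteDimensional F V] {M : Type*}
    [AddCommGroup M] {n : ℕ} {φ : (Fin n → ℙ F V) → (Fin n → ℙ F V) → M} (hφ : IsBimodularSymbol φ)
    (hn : Module.finrank F V = n) {L : Submodule F V} (hL : Module.finrank F L = 1)
    (h : ∀ P Q : Fin n → ℙ F V, IsCoxeterTuple P Q →
      (∀ i : Fin n, (i : ℕ) = 0 → (P i).submodule = L ∧ (Q i).submodule = L) → φ P Q = 0)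
    (P Q : Fin n → ℙ F V) : φ P Q = 0 := by
  rcases n with _ | n
  · have := L.finrank_le
    omega
  refine hφ.eq_zero_of_coxeter_point (W := ⊤) (by rw [finrank_top, hn])
    (x := Projectivization.mk'' L hL) le_top (fun P' Q' hPQ hP hQ => h P' Q' hPQ fun i hi => ?_)
    (fun _ => le_top) (fun _ => le_top)
  obtain rfl : i = 0 := Fin.ext hi
  rw [hP, hQ, Projectivization.submodule_mk'']
  exact ⟨rfl, rfl⟩

end SteinbergCoxeter

end

theorem mainTheorem3 (F : Type*) [Field F] (V : Type*) [AddCommGroup V] [Module F V]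
    [FiniteDimensional F V] :
    (∀ H : Submodule F V, Module.finrank F H + 1 = Module.finrank F V →
      Submodule.span ℚ {x : Steinberg F V ⊗[ℚ] Steinberg F V |
        ∃ P Q : Fin (Module.finrank F V) → ℙ F V, IsCoxeterPair P Q ∧
          (∀ i : Fin (Module.finrank F V), (i : ℕ) + 1 < Module.finrank F V →
            (P i).submodule ≤ H) ∧
          x = apartment P ⊗ₜ[ℚ] apartment Q} = ⊤) ∧
    (∀ L : Submodule F V, Module.finrank F L = 1 →
      Submodule.span ℚ {x : Steinberg F V ⊗[ℚ] Steinberg F V |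
        ∃ P Q : Fin (Module.finrank F V) → ℙ F V, IsCoxeterPair P Q ∧
          (∀ i : Fin (Module.finrank F V), (i : ℕ) = 0 →
            (P i).submodule = L ∧ (Q i).submodule = L) ∧
          x = apartment P ⊗ₜ[ℚ] apartment Q} = ⊤) := by
  refine ⟨fun H hH => eq_top_of_apartment_tmul_mem ?_, fun L hL => eq_top_of_apartment_tmul_mem ?_⟩
  · refine (isBimodularSymbol_apartment_tmul _).eq_zero_of_coxeter_le_hyperplane rfl hH
      fun P Q hPQ hP => ?_
    rw [Submodule.mkQ_apply, Submodule.Quotient.mk_eq_zero]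
    exact Submodule.subset_span ⟨P, Q, isCoxeterPair_iff.2 hPQ, hP, rfl⟩
  · refine (isBimodularSymbol_apartment_tmul _).eq_zero_of_coxeter_line rfl hL
      fun P Q hPQ hP => ?_
    rw [Submodule.mkQ_apply, Submodule.Quotient.mk_eq_zero]
    exact Submodule.subset_span ⟨P, Q, isCoxeterPair_iff.2 hPQ, hP, rfl⟩
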